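/- Let $\tau\in\mathbb C$ with $\operatorname{Im}\tau>0$, $\Lambda=\mathbb Z+\tau\mathbb Z$, let $\wp$ be the Weierstrass function of $\Lambda$ and $$\theta_1(v)=e^{\frac{i\pi}{4}\tau+i\pi(v+\frac12)}\sum_{n\in\mathbb Z}e^{i\pi n^2\tau+2\pi i n(v+\frac12+\frac\tau2)} .$$ Let $\alpha,\beta\in\mathbb R$ and $\mathcal X=\beta-\tau\alpha$, with $\theta_1(\mathcal X)\neq0$. Put $$S(v,w)=e^{2\pi i\alpha(v-w)}\frac{\theta_1'(0)\,\theta_1(v-w-\mathcal X)}{\theta_1(\mathcal X)\,\theta_1(w-v)},\qquad \varphi_\ell(v)=\partial_w^\ell S(v,w)\big|_{w=0}\ (\ell=0,1),\qquad \Psi_0=\begin{pmatrix}\varphi_0(v)&\varphi_0(-v)\\ \varphi_1(v)&\varphi_1(-v)\end{pmatrix},\quad z=\wp(v).$$ Let $R\ge1$ and $a,b\in\mathbb Z$ be such that $q=\frac{b+a\tau}{2R}$ is not a half-period, i.e. $2q\notin\Lambda$. Put $z_\star=\wp(q)$, $$Y(v)=\Big(e^{2\pi i\frac aR v}\,\frac{\theta_1(v+q)}{\theta_1(v-q)}\Big)^R,\qquad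 \sqrt W(z)=\Psi_0\begin{pmatrix}Y(v)&0\\0&Y(-v)\end{pmatrix}\Psi_0^{-1},\quad z=\wp(v).$$ Then there are $r>0$ and a holomorphic function $w\mapsto w^{(1)}$ on the disc $|w-z_\star|<r$ with $\wp(w^{(1)})=w$ and $z_\star^{(1)}=q$. For $w$ in this disc write $\Psi_0(w)$ for the matrix $\Psi_0$ with $v=w^{(1)}$, and let $\mathbb E_{11}=\operatorname{diag}(1,0)$. For $0<\varepsilon<r$ and $|z-z_\star|>\varepsilon$, with $z\in\mathbb C$ not one of the three values of $\wp$ at the nonzero half-periods, put $$P_{R-1}(z)=(z-z_\star)^R\left(\oint_{|w-z_\star|=\varepsilon}\Psi_0(w)\,\mathbb E_{11}\,\Psi_0(w)^{-1}\,\frac{dw}{2\pi i\,(w-z_\star)^{2R}(w-z)}\right)\big(\sqrt W(z)\big)^{-1}.$$ Then $P_{R-1}$ is the restriction of a $2\times2$ matrix polynomial in $z$, the same for all choices of $r$, $w^{(1)}$ and $\varepsilon$. It has degree at most $R-1$, and its degree is exactly $R-1$ (its coefficient of $z^{R-1}$ is not the zero matrix) whenever $2\alpha$ and $2\beta$ are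 not both integers. -/

import Mathlib

namespace GenusOneTorsion

noncomputable section

/-- The pair of periods `(1, τ)`, for `τ` in the upper half plane. -/
def periods (τ : UpperHalfPlane) : PeriodPair where
  ω₁ := 1
  ω₂ := (τ : ℂ)
  indep := by
    rw [LinearIndependent.pair_iff]
    intro s t h
    have him := congrArg Complex.im h
    have hre := congrArg Complex.re h
    simp at him hre
    have ht : t = 0 := him.resolve_right τ.im_ne_zero
    subst ht
    simpa using hre

/-- The Weierstrass function `℘` of the lattice `ℤ + τℤ`; the coordinate `z` on the `z`-plane
is `z = ℘(v)`. -/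
def wp (τ : UpperHalfPlane) (v : ℂ) : ℂ := (periods τ).weierstrassP v

/-- The odd Jacobi theta function
`θ₁(v) = exp(iπτ/4 + iπ(v + 1/2)) ∑ₙ exp(iπn²τ + 2πin(v + 1/2 + τ/2))`. -/
def theta1 (τ : UpperHalfPlane) (v : ℂ) : ℂ :=
  Complex.exp (Real.pi * Complex.I / 4 * τ + Complex.I * Real.pi * (v + 1 / 2)) *
    jacobiTheta₂ (v + 1 / 2 + τ / 2) τ

/-- The point `𝒳 = β - τα` of the Jacobian attached to the unitary character with multipliers
`exp(2πiα)` (along `v ↦ v + 1`) and `exp(2πiβ)` (along `v ↦ v + τ`). -/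
def charPoint (τ : UpperHalfPlane) (α β : ℝ) : ℂ := β - τ * α

/-- The Szegő kernel, i.e. the coefficient of `√dv √dw`. -/
def szego (τ : UpperHalfPlane) (α β : ℝ) (v w : ℂ) : ℂ :=
  Complex.exp (2 * Real.pi * Complex.I * α * (v - w)) *
    (deriv (theta1 τ) 0 * theta1 τ (v - w - charPoint τ α β)) /
      (theta1 τ (charPoint τ α β) * theta1 τ (w - v))

/-- The section `φ_ℓ(v) = ∂_w^ℓ S(v,w)` at `w = 0`, i.e. the coefficient of `√dv`. -/
def phi (τ : UpperHalfPlane) (α β : ℝ) (l : ℕ) (v : ℂ) : ℂ :=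
  iteratedDeriv l (fun w => szego τ α β v w) 0

/-- The matrix `Ψ₀ = Φ`, whose columns are the values of `(φ₀, φ₁)` at the two points `v`, `-v`
above `z = ℘(v)`, the first column belonging to `v`. -/
def Psi0 (τ : UpperHalfPlane) (α β : ℝ) (v : ℂ) : Matrix (Fin 2) (Fin 2) ℂ :=
  !![phi τ α β 0 v, phi τ α β 0 (-v);
     phi τ α β 1 v, phi τ α β 1 (-v)]

/-- The torsion point `q = (b + aτ)/(2R)`. -/
def torsionPt (τ : UpperHalfPlane) (a b : ℤ) (R : ℕ) : ℂ := (b + a * τ) / (2 * R)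

/-- `z_⋆ = ℘(q)`. -/
def zStar (τ : UpperHalfPlane) (a b : ℤ) (R : ℕ) : ℂ := wp τ (torsionPt τ a b R)

/-- The elliptic function `Y(v) = (exp(2πi a v / R) θ₁(v + q) / θ₁(v - q))^R`. -/
def Y (τ : UpperHalfPlane) (a b : ℤ) (R : ℕ) (v : ℂ) : ℂ :=
  (Complex.exp (2 * Real.pi * Complex.I * (a / R) * v) *
    (theta1 τ (v + torsionPt τ a b R) / theta1 τ (v - torsionPt τ a b R))) ^ R

/-- The square root `√W(z) = Φ diag(Y(z⁽¹⁾), Y(z⁽²⁾)) Φ⁻¹` of the weight matrix at `z = ℘(v)`,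
computed with `z⁽¹⁾ = v`, `z⁽²⁾ = -v` (exchanging the two points does not change it). -/
def sqrtW (τ : UpperHalfPlane) (α β : ℝ) (a b : ℤ) (R : ℕ) (v : ℂ) : Matrix (Fin 2) (Fin 2) ℂ :=
  Psi0 τ α β v * !![Y τ a b R v, 0; 0, Y τ a b R (-v)] * (Psi0 τ α β v)⁻¹

/-- `V` parametrizes the first sheet over the disc `|w - z_⋆| < r`: it is the holomorphic function
`w ↦ w⁽¹⁾` with `℘(w⁽¹⁾) = w` and `z_⋆⁽¹⁾ = q`, the point where `Y` has its pole. -/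
structure IsFirstSheet (τ : UpperHalfPlane) (a b : ℤ) (R : ℕ) (r : ℝ) (V : ℂ → ℂ) : Prop where
  differentiableOn : DifferentiableOn ℂ V (Metric.ball (zStar τ a b R) r)
  wp_eq : ∀ w ∈ Metric.ball (zStar τ a b R) r, wp τ (V w) = w
  base : V (zStar τ a b R) = torsionPt τ a b R

/-- The matrix `Ψ₀(w) E₁₁ Ψ₀(w)⁻¹`, the first column of `Ψ₀(w)` being taken at `w⁽¹⁾ = V w`. -/
def proj (τ : UpperHalfPlane) (α β : ℝ) (V : ℂ → ℂ) (w : ℂ) : Matrix (Fin 2) (Fin 2) ℂ :=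
  Psi0 τ α β (V w) * !![1, 0; 0, 0] * (Psi0 τ α β (V w))⁻¹

/-- The matrix of contour integrals (taken entrywise)
`(2πi)⁻¹ ∮_{|w - z_⋆| = ε} Ψ₀(w) E₁₁ Ψ₀(w)⁻¹ dw / ((w - z_⋆)^{2R} (w - z))`. -/
def contour (τ : UpperHalfPlane) (α β : ℝ) (a b : ℤ) (R : ℕ) (V : ℂ → ℂ) (ε : ℝ) (z : ℂ) :
    Matrix (Fin 2) (Fin 2) ℂ :=
  Matrix.of fun i j =>
    (2 * Real.pi * Complex.I)⁻¹ *
      circleIntegral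
        (fun w => proj τ α β V w i j / ((w - zStar τ a b R) ^ (2 * R) * (w - z)))
        (zStar τ a b R) ε

/-- The matrix `P_{R-1}(z)`, at `z = ℘(v)`, given by the contour integral formula
`(z - z_⋆)^R (2πi)⁻¹ ∮ Ψ₀(w) E₁₁ Ψ₀(w)⁻¹ dw / ((w - z_⋆)^{2R} (w - z)) √W(z)⁻¹`. -/
def PR1 (τ : UpperHalfPlane) (α β : ℝ) (a b : ℤ) (R : ℕ) (V : ℂ → ℂ) (ε : ℝ) (v : ℂ) :
    Matrix (Fin 2) (Fin 2) ℂ :=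
  (wp τ v - zStar τ a b R) ^ R •
    (contour τ α β a b R V ε (wp τ v) * (sqrtW τ α β a b R v)⁻¹)

end

end GenusOneTorsion

/-! ### The lattice and the theta function. -/

namespace GenusOneTorsion

open Complex Filter Topology

/-! Put `z = ℘(v)`, `y = ℘'(v)`, so that `y² = p(z)` with `p` a cubic. Both factors of `PR1` are
expressed through one polynomial matrix `M(z)`. Products of Szegő sections at `v` and `-v` are
elliptic with poles only on the lattice, whence `Ψ₀ diag(s, t) Ψ₀⁻¹ = (s + t)/2 + (s - t)/(2y) M`
with `M² = p` (`exists_isSpectralMatrix`). Because `q` is torsion, `(z - z⋆)^R Y(±v)` is elliptic,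
of the form `e(z) ∓ y o(z)`, and `Y(v) Y(-v) = 1` becomes the Pell equation `e² - p o² = (z -
z⋆)^(2R)` (`exists_isPellPair`). Hence `(z - z⋆)^R √W⁻¹ = e + o M` (`smul_sqrtW_inv`).

The projector `Ψ₀ E₁₁ Ψ₀⁻¹` is `(1 + M/y)/2`. On the first sheet `1/y` agrees with a polynomial `σ`
to order `2R` at `z⋆`. As `z` lies outside the circle, the contour integral is `-T(z)/(z -
z⋆)^(2R)`, where `T` is the Taylor polynomial of `(1 + σM)/2` of degree below `2R` (`contour_eq`).
Modulo `(z - z⋆)^(2R)`, `σ²p = 1`, so `2T(e + oM) = (e + σpo) + (o + σe)M` and the Pell equation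
reads `(e - σpo)(e + σpo) = 0`. The first factor is nonzero at `z⋆`, where it is the value at `q` of
`(℘ - z⋆)^R Y`, so both brackets vanish (`dvd_truncMat_mul`). Dividing out leaves a polynomial of
degree at most `(2R - 1) + R - 2R = R - 1`.

If its top coefficient were zero, so would be that of `T`, since the `z^R` coefficient of `e + oM`
is triangular with diagonal `(-1)^R`. When `2𝒳` is not a period, the shape of `M` then makes the
Taylor coefficients of `p^(-1/2)` at `z⋆` of index `2R - 1`, `2R - 2` and, if `R ≥ 2`, `2R - 3`
vanish. The equation `2pσ' + p'σ = 0` propagates this down to the constant term `1/℘'(q)`, which is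
not zero (`coeff_inv_sqrt_cubic`).

The facts needed on `θ₁` and `℘` (zeros of `θ₁`, product formula for `℘(c) - ℘(v)`) follow from any
three theta functions of degree two being linearly dependent. -/

lemma mem_lattice_iff {τ : UpperHalfPlane} {x : ℂ} :
    x ∈ (periods τ).lattice ↔ ∃ m n : ℤ, (m : ℂ) + n * τ = x := by
  simp [PeriodPair.mem_lattice, periods]

lemma one_mem_lattice (τ : UpperHalfPlane) : (1 : ℂ) ∈ (periods τ).lattice :=
  mem_lattice_iff.2 ⟨1, 0, by simp⟩

lemma tau_mem_lattice (τ : UpperHalfPlane) : (τ : ℂ) ∈ (periods τ).lattice :=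
  mem_lattice_iff.2 ⟨0, 1, by simp⟩

lemma periodic_of_add_one_of_add_tau {τ : UpperHalfPlane} {E : Type*} {f : ℂ → E}
    (h1 : ∀ v, f (v + 1) = f v) (hτ : ∀ v, f (v + τ) = f v) {l : ℂ}
    (hl : l ∈ (periods τ).lattice) (v : ℂ) : f (v + l) = f v := by
  obtain ⟨m, n, rfl⟩ := mem_lattice_iff.1 hl
  have h1' : Function.Periodic f 1 := h1
  have hτ' : Function.Periodic f (τ : ℂ) := hτ
  rw [← add_assoc, hτ'.int_mul n, ← mul_one (m : ℂ), h1'.int_mul m]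

lemma dense_compl_lattice (τ : UpperHalfPlane) : Dense ((periods τ).lattice : Set ℂ)ᶜ :=
  Set.Countable.dense_compl ℂ (by
    have : Countable (periods τ).lattice := inferInstance
    exact Set.countable_coe_iff.1 this)

lemma isOpen_compl_lattice (τ : UpperHalfPlane) : IsOpen ((periods τ).lattice : Set ℂ)ᶜ :=
  (periods τ).isClosed_lattice.isOpen_compl

lemma eq_of_eq_off_lattice {τ : UpperHalfPlane} {f g : ℂ → ℂ} (hf : Continuous f)
    (hg : Continuous g) (h : ∀ v ∉ (periods τ).lattice, f v = g v) (v : ℂ) : f v = g v :=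
  congrFun (hf.ext_on (dense_compl_lattice τ) hg fun v hv => h v hv) v

lemma eventually_notMem_lattice (τ : UpperHalfPlane) (c : ℂ) :
    ∀ᶠ v in 𝓝[≠] c, v ∉ (periods τ).lattice := by
  have h := (periods τ).compl_lattice_sdiff_singleton_mem_nhds c
  filter_upwards [nhdsWithin_le_nhds h, self_mem_nhdsWithin] with v hv hne hl
  exact hv ⟨hl, hne⟩

/-! ### The theta function -/

lemma differentiable_theta1 (τ : UpperHalfPlane) : Differentiable ℂ (theta1 τ) := by
  intro v
  have h := DifferentiableAt.comp (g := (jacobiTheta₂ · τ)) (f := fun v => v + 1 / 2 + (τ : ℂ) / 2) v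
    (differentiableAt_jacobiTheta₂_fst (v + 1 / 2 + τ / 2) τ.im_pos) (by fun_prop)
  exact DifferentiableAt.mul (a := fun v => cexp (Real.pi * I / 4 * τ + I * Real.pi * (v + 1 / 2)))
    (by fun_prop) h

lemma theta1_add_one (τ : UpperHalfPlane) (v : ℂ) : theta1 τ (v + 1) = -theta1 τ v := by
  unfold theta1
  rw [show v + 1 + 1 / 2 + (τ : ℂ) / 2 = v + 1 / 2 + τ / 2 + 1 by ring, jacobiTheta₂_add_left,
    show (Real.pi * I / 4 * τ + I * Real.pi * (v + 1 + 1 / 2) : ℂ) =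
      Real.pi * I / 4 * τ + I * Real.pi * (v + 1 / 2) + Real.pi * I by ring, Complex.exp_add,
    Complex.exp_pi_mul_I]
  ring

lemma theta1_add_tau (τ : UpperHalfPlane) (v : ℂ) :
    theta1 τ (v + τ) = -cexp (-Real.pi * I * (τ + 2 * v)) * theta1 τ v := by
  unfold theta1
  rw [show v + τ + 1 / 2 + (τ : ℂ) / 2 = v + 1 / 2 + τ / 2 + τ by ring, jacobiTheta₂_add_left',
    ← mul_assoc, ← mul_assoc, ← Complex.exp_add, ← neg_one_mul (cexp _),
    ← Complex.exp_pi_mul_I, ← Complex.exp_add, ← Complex.exp_add]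
  have : ∀ z : ℂ, cexp (z - 2 * Real.pi * I) = cexp z := fun z => by
    rw [Complex.exp_sub, Complex.exp_two_pi_mul_I, div_one]
  congr 1
  rw [← this (Real.pi * I + _ + _)]
  congr 1
  ring

lemma theta1_neg (τ : UpperHalfPlane) (v : ℂ) : theta1 τ (-v) = -theta1 τ v := by
  have h1 : jacobiTheta₂ (-v + 1 / 2 + τ / 2) τ = jacobiTheta₂ (v - 1 / 2 - τ / 2) τ := by
    rw [← jacobiTheta₂_neg_left]; congr 1; ring
  have h2 : jacobiTheta₂ (v + 1 / 2 + τ / 2) τ =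
      cexp (-Real.pi * I * (τ + 2 * (v - 1 / 2 - τ / 2))) *
        jacobiTheta₂ (v - 1 / 2 - τ / 2) τ := by
    rw [← jacobiTheta₂_add_left', ← jacobiTheta₂_add_left (v - 1 / 2 - τ / 2 + τ)]; congr 1; ring
  unfold theta1
  rw [h1, h2, ← mul_assoc, ← Complex.exp_add, ← neg_mul, ← neg_one_mul (cexp _),
    ← Complex.exp_pi_mul_I, ← Complex.exp_add]
  have : ∀ z : ℂ, cexp (z - 2 * Real.pi * I) = cexp z := fun z => by
    rw [Complex.exp_sub, Complex.exp_two_pi_mul_I, div_one]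
  congr 1
  rw [← this (Real.pi * I + _)]
  congr 1
  ring

lemma theta1_zero (τ : UpperHalfPlane) : theta1 τ 0 = 0 := by
  have := theta1_neg τ 0
  rw [neg_zero] at this
  linear_combination this / 2

lemma theta1_eq_zero_of_mem {τ : UpperHalfPlane} {l : ℂ} (hl : l ∈ (periods τ).lattice) :
    theta1 τ l = 0 := by
  have := periodic_of_add_one_of_add_tau (τ := τ) (f := fun v => theta1 τ v = 0)
    (fun v => by simp [theta1_add_one]) (fun v => by simp [theta1_add_tau]) hl 0
  simp only [zero_add, theta1_zero] at this
  simpa using this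

lemma integral_exp_int_mul (n : ℤ) (hn : n ≠ 0) (c : ℂ) :
    ∫ x : ℝ in (0 : ℝ)..1, cexp (2 * Real.pi * I * n * x + c) = 0 := by
  have h0 : (2 * Real.pi * I * n : ℂ) ≠ 0 := by
    simp [Real.pi_ne_zero, hn]
  have := integral_exp_mul_complex (a := 0) (b := 1) h0
  simp_rw [Complex.exp_add, intervalIntegral.integral_mul_const, this]
  have h1 : cexp (2 * Real.pi * I * n) = 1 := by
    rw [mul_comm]; exact Complex.exp_int_mul_two_pi_mul_I n
  simp [h1]

lemma integral_jacobiTheta₂ {t : ℂ} (ht : 0 < t.im) :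
    ∫ x : ℝ in (0 : ℝ)..1, jacobiTheta₂ x t = 1 := by
  have h := intervalIntegral.hasSum_intervalIntegral_of_summable_norm (a := 0) (b := 1)
    (f := fun n : ℤ => (⟨fun x : ℝ => jacobiTheta₂_term n x t, by
      unfold jacobiTheta₂_term; fun_prop⟩ : C(ℝ, ℂ))) ?_
  · have h' : (∑' n : ℤ, ∫ x : ℝ in (0 : ℝ)..1, jacobiTheta₂_term n x t) = 1 := by
      rw [tsum_eq_single 0]
      · simp [jacobiTheta₂_term]
      · intro n hn
        simpa [jacobiTheta₂_term] using integral_exp_int_mul n hn (Real.pi * I * n ^ 2 * t)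
    have h2 := h.tsum_eq
    simp only [ContinuousMap.coe_mk] at h2
    rw [h'] at h2
    exact h2.symm
  · have := (summable_pow_mul_jacobiTheta₂_term_bound 0 ht 0)
    refine this.of_nonneg_of_le (fun _ => norm_nonneg _) fun n => ?_
    rw [ContinuousMap.norm_le _ (by positivity)]
    intro x
    simpa using norm_jacobiTheta₂_term_le (S := 0) ht (z := ((x : ℝ) : ℂ)) (by simp) le_rfl n

/-- The constant Fourier coefficient of the theta series is `1`, so the series cannot vanish
identically. -/
lemma exists_theta1_ne_zero (τ : UpperHalfPlane) : ∃ v, theta1 τ v ≠ 0 := by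
  by_contra! h
  have h0 : ∀ z, jacobiTheta₂ z τ = 0 := fun z => by
    have := h (z - 1 / 2 - τ / 2)
    unfold theta1 at this
    rw [mul_eq_zero, or_iff_right (Complex.exp_ne_zero _)] at this
    rw [← this]; congr 1; ring
  have := integral_jacobiTheta₂ τ.im_pos
  simp_all

lemma eventually_theta1_ne_zero (τ : UpperHalfPlane) (c : ℂ) :
    ∀ᶠ v in 𝓝[≠] c, theta1 τ v ≠ 0 := by
  have ha : AnalyticOnNhd ℂ (theta1 τ) Set.univ :=
    fun v _ => (differentiable_theta1 τ).analyticAt v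
  rcases (ha c trivial).eventually_eq_zero_or_eventually_ne_zero with h | h
  · obtain ⟨v, hv⟩ := exists_theta1_ne_zero τ
    exact absurd (congrFun (ha.eq_of_eventuallyEq (g := fun _ => 0)
      (fun v _ => analyticAt_const) h) v) hv
  · exact h

/-! ### Theta functions of degree two -/

/-- For a primitive `G` of `g`, the integral is `G (1 + w) - G w`, whose derivative in `w` vanishes
by periodicity. Primitives are taken on a ball large enough to contain all segments from `u` to `u +
1` with `‖u‖ ≤ ‖w‖ + 1`. -/
lemma integral_add_of_periodic {g : ℂ → ℂ} (hg : Differentiable ℂ g)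
    (h1 : ∀ v, g (v + 1) = g v) (w : ℂ) :
    ∫ x : ℝ in (0 : ℝ)..1, g (x + w) = ∫ x : ℝ in (0 : ℝ)..1, g x := by
  obtain ⟨G, hG⟩ := (hg.differentiableOn (s := Metric.ball 0 (‖w‖ + 3))).isExactOn_ball
  have key : ∀ u : ℂ, ‖u‖ ≤ ‖w‖ + 1 → ∫ x : ℝ in (0 : ℝ)..1, g (x + u) = G (1 + u) - G u := by
    intro u hu
    have := intervalIntegral.integral_eq_sub_of_hasDerivAt (a := 0) (b := 1)
      (f := fun x : ℝ => G (x + u)) (f' := fun x : ℝ => g (x + u)) (fun x hx => ?_) ?_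
    · simpa using this
    · rw [Set.uIcc_of_le zero_le_one] at hx
      refine HasDerivAt.comp_ofReal (e := fun z => G (z + u)) ?_
      refine HasDerivAt.comp_add_const (x : ℂ) u (hG _ ?_)
      rw [mem_ball_zero_iff]
      refine (norm_add_le _ _).trans_lt ?_
      rw [Complex.norm_real, Real.norm_eq_abs, abs_of_nonneg hx.1]
      linarith [hx.2]
    · exact (hg.continuous.comp (by fun_prop)).intervalIntegrable _ _
  have hd : ∀ u ∈ Metric.ball (0 : ℂ) (‖w‖ + 1),
      HasDerivAt (fun u => G (1 + u) - G u) 0 u := by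
    intro u hu
    rw [mem_ball_zero_iff] at hu
    have e1 := HasDerivAt.comp_const_add 1 u (hG (1 + u) ?_)
    · have e2 := hG u (by rw [mem_ball_zero_iff]; linarith)
      have := e1.sub e2
      rw [add_comm 1 u, h1, sub_self] at this
      exact this
    · rw [mem_ball_zero_iff]
      refine (norm_add_le _ _).trans_lt ?_
      rw [norm_one]; linarith
  have hc := (convex_ball (0 : ℂ) (‖w‖ + 1)).is_const_of_fderivWithin_eq_zero (𝕜 := ℂ)
    (f := fun u => G (1 + u) - G u)
    (fun u hu => (hd u hu).differentiableAt.differentiableWithinAt) (fun u hu => by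
      rw [fderivWithin_of_isOpen Metric.isOpen_ball hu]
      ext
      simpa using (hd u hu).deriv) (x := w) (y := 0) (by simp) (by simp; positivity)
  have k0 := key 0 (by simp; positivity)
  simp only [add_zero] at k0 hc
  rw [key w (by linarith), hc, k0]

/-- Shifting the contour by `τ` links the Fourier coefficients of index `n` and `n + 2` by a nonzero
factor, so the coefficients of index `0` and `1` determine all others. Vanishing on the real line
then spreads to the plane by the identity theorem. -/
lemma quasiperiodic_eq_zero {τ : UpperHalfPlane} {f : ℂ → ℂ} (hf : Differentiable ℂ f)
    (h1 : ∀ v, f (v + 1) = f v)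
    (hτ : ∀ v, f (v + τ) = cexp (-2 * Real.pi * I * (τ + 2 * v)) * f v)
    (c0 : ∫ x : ℝ in (0 : ℝ)..1, f x = 0)
    (c1 : ∫ x : ℝ in (0 : ℝ)..1, cexp (-(2 * Real.pi * I * x)) * f x = 0) (v : ℂ) : f v = 0 := by
  set c : ℤ → ℂ := fun n => ∫ x : ℝ in (0 : ℝ)..1, cexp (-(2 * Real.pi * I * n * x)) * f x with hc
  have hrec : ∀ n : ℤ, c n = cexp (-(2 * Real.pi * I * (n + 1) * τ)) * c (n + 2) := by
    intro n
    have := integral_add_of_periodic (g := fun z => cexp (-(2 * Real.pi * I * n * z)) * f z)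
      (by fun_prop) (fun z => by
        have h2 : cexp (-(2 * Real.pi * I * n * 1)) = 1 := by
          rw [Complex.exp_neg, mul_one, mul_comm, Complex.exp_int_mul_two_pi_mul_I, inv_one]
        rw [h1, mul_add, neg_add, Complex.exp_add, h2, mul_one]) τ
    rw [hc]
    simp only
    rw [← this, ← intervalIntegral.integral_const_mul]
    congr 1 with x
    rw [hτ, ← mul_assoc, ← mul_assoc, ← Complex.exp_add, ← Complex.exp_add]
    congr 2
    push_cast
    ring
  have hz : ∀ n : ℤ, c n = 0 ∧ c (n + 1) = 0 := by
    intro n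
    induction n using Int.induction_on with
    | zero => simpa [hc] using ⟨c0, c1⟩
    | succ i ih =>
      refine ⟨ih.2, ?_⟩
      have := hrec i
      rw [ih.1, eq_comm, mul_eq_zero, or_iff_right (Complex.exp_ne_zero _)] at this
      rw [add_assoc]
      exact this
    | pred i ih =>
      refine ⟨?_, by rw [sub_add_cancel]; exact ih.1⟩
      rw [hrec, show -(i : ℤ) - 1 + 2 = -i + 1 by ring, ih.2, mul_zero]
  have : Fact ((0 : ℝ) < 1) := ⟨one_pos⟩
  have hp : Function.Periodic (fun x : ℝ => f x) 1 := fun x => by simpa using h1 x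
  let F : C(AddCircle (1 : ℝ), ℂ) := ⟨hp.lift, by
    refine continuous_coinduced_dom.2 ?_
    have : Continuous (fun x : ℝ => f x) := hf.continuous.comp Complex.continuous_ofReal
    exact this⟩
  have hF : ∀ x : ℝ, F (x : AddCircle (1 : ℝ)) = f x := fun x => rfl
  have hcoef : fourierCoeff F = 0 := by
    ext n
    rw [fourierCoeff_eq_intervalIntegral _ n 0]
    simp only [hF, zero_add, div_one, one_smul, Pi.zero_apply, smul_eq_mul]
    rw [← (hz n).1, hc]
    congr 1 with x
    rw [fourier_coe_apply]
    congr 2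
    push_cast
    ring
  have hreal : ∀ x : ℝ, f x = 0 := by
    intro x
    have := has_pointwise_sum_fourier_series_of_summable (f := F)
      (by rw [hcoef]; exact summable_zero) x
    rw [hcoef] at this
    simp only [Pi.zero_apply, zero_smul, hF] at this
    exact this.unique hasSum_zero
  have ha : AnalyticOnNhd ℂ f Set.univ := fun v _ => hf.analyticAt v
  refine congrFun (ha.eq_of_frequently_eq (z₀ := 0) (g := fun _ => 0)
    (fun v _ => analyticAt_const) ?_) v
  have ht : Tendsto (fun x : ℝ => (x : ℂ)) (𝓝[≠] 0) (𝓝[≠] 0) := by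
    refine tendsto_nhdsWithin_iff.2 ⟨?_, ?_⟩
    · have : Tendsto (fun x : ℝ => (x : ℂ)) (𝓝 0) (𝓝 ((0 : ℝ) : ℂ)) :=
        Complex.continuous_ofReal.tendsto 0
      simpa using this.mono_left nhdsWithin_le_nhds
    · filter_upwards [self_mem_nhdsWithin] with x hx
      simpa using hx
  exact ht.frequently (Eventually.of_forall fun x => hreal x).frequently

end GenusOneTorsion

/-! ### The Weierstrass function in terms of theta functions. -/

namespace GenusOneTorsion

open Complex Filter Topology

lemma wp_neg (τ : UpperHalfPlane) (v : ℂ) : wp τ (-v) = wp τ v :=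
  (periods τ).weierstrassP_neg v

lemma wp_add_mem {τ : UpperHalfPlane} {l : ℂ} (hl : l ∈ (periods τ).lattice) (v : ℂ) :
    wp τ (v + l) = wp τ v :=
  (periods τ).weierstrassP_add_coe v ⟨l, hl⟩

lemma analyticAt_wp {τ : UpperHalfPlane} {v : ℂ} (hv : v ∉ (periods τ).lattice) :
    AnalyticAt ℂ (wp τ) v :=
  (periods τ).analyticOnNhd_weierstrassP v hv

/-- A function analytic at `0` that extends `v² ℘(v)`. -/
lemma exists_analyticAt_sq_mul_wp (τ : UpperHalfPlane) :
    ∃ g : ℂ → ℂ, AnalyticAt ℂ g 0 ∧ g 0 = 1 ∧ ∀ v, v ≠ 0 → g v = v ^ 2 * wp τ v := by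
  refine ⟨fun v => v ^ 2 * (periods τ).weierstrassPExcept 0 v + 1, ?_, by simp, fun v hv => ?_⟩
  · have := (periods τ).analyticAt_weierstrassPExcept 0
    fun_prop
  · have := (periods τ).ite_eq_one_sub_sq_mul_weierstrassP 0 (zero_mem _) v
    simp only [hv, if_false, sub_zero] at this
    simp [wp, this]

/-- The entire function that extends `θ₁² ℘`. -/
noncomputable def thetaSqWp (τ : UpperHalfPlane) (v : ℂ) : ℂ :=
  open Classical in
  if v ∈ (periods τ).lattice then deriv (theta1 τ) v ^ 2 else theta1 τ v ^ 2 * wp τ v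

lemma thetaSqWp_of_notMem {τ : UpperHalfPlane} {v : ℂ} (hv : v ∉ (periods τ).lattice) :
    thetaSqWp τ v = theta1 τ v ^ 2 * wp τ v := if_neg hv

lemma thetaSqWp_zero (τ : UpperHalfPlane) : thetaSqWp τ 0 = deriv (theta1 τ) 0 ^ 2 :=
  if_pos (zero_mem _)

lemma differentiable_thetaSqWp (τ : UpperHalfPlane) : Differentiable ℂ (thetaSqWp τ) := by
  intro l
  by_cases hl : l ∈ (periods τ).lattice
  · have h : DifferentiableAt ℂ (fun v => theta1 τ v ^ 2 *
        ((periods τ).weierstrassPExcept l v - 1 / l ^ 2) + dslope (theta1 τ) l v ^ 2) l := by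
      have h1 : DifferentiableAt ℂ (dslope (theta1 τ) l) l :=
        ((differentiableOn_dslope Filter.univ_mem).2
          (differentiable_theta1 τ).differentiableOn).differentiableAt Filter.univ_mem
      have h2 := differentiable_theta1 τ l
      have h3 := ((periods τ).analyticAt_weierstrassPExcept l).differentiableAt
      fun_prop
    refine h.congr_of_eventuallyEq ?_
    filter_upwards [(periods τ).compl_lattice_sdiff_singleton_mem_nhds l] with v hv
    by_cases hvl : v = l
    · subst hvl
      simp [thetaSqWp, hl, theta1_eq_zero_of_mem hl]
    · have hv' : v ∉ (periods τ).lattice := fun h => hv ⟨h, hvl⟩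
      have hs : v - l ≠ 0 := sub_ne_zero.2 hvl
      rw [thetaSqWp_of_notMem hv', wp, ← (periods τ).weierstrassPExcept_add ⟨l, hl⟩,
        dslope_of_ne _ hvl, slope_def_field, theta1_eq_zero_of_mem hl]
      field_simp
      ring
  · have h : DifferentiableAt ℂ (fun v => theta1 τ v ^ 2 * wp τ v) l :=
      ((differentiable_theta1 τ l).pow 2).mul (analyticAt_wp hl).differentiableAt
    refine h.congr_of_eventuallyEq ?_
    filter_upwards [(isOpen_compl_lattice τ).mem_nhds hl] with v hv
    exact thetaSqWp_of_notMem hv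

/-- Theta functions of degree two with the multipliers of `θ₁²`. -/
structure IsThetaTwo (τ : UpperHalfPlane) (f : ℂ → ℂ) : Prop where
  differentiable : Differentiable ℂ f
  add_one : ∀ v, f (v + 1) = f v
  add_tau : ∀ v, f (v + τ) = cexp (-2 * Real.pi * I * (τ + 2 * v)) * f v

lemma isThetaTwo_mul (τ : UpperHalfPlane) (c : ℂ) :
    IsThetaTwo τ (fun v => theta1 τ (v - c) * theta1 τ (v + c)) where
  differentiable := by
    have := differentiable_theta1 τ
    fun_prop
  add_one v := by
    rw [show v + 1 - c = v - c + 1 by ring, show v + 1 + c = v + c + 1 by ring, theta1_add_one,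
      theta1_add_one]
    ring
  add_tau v := by
    rw [show v + τ - c = v - c + τ by ring, show v + τ + c = v + c + τ by ring, theta1_add_tau,
      theta1_add_tau, show (-2 * Real.pi * I * (τ + 2 * v) : ℂ) =
        -Real.pi * I * (τ + 2 * (v - c)) + -Real.pi * I * (τ + 2 * (v + c)) by ring,
      Complex.exp_add]
    ring

lemma isThetaTwo_sq (τ : UpperHalfPlane) : IsThetaTwo τ (fun v => theta1 τ v ^ 2) := by
  simpa [sq] using isThetaTwo_mul τ 0

lemma isThetaTwo_thetaSqWp (τ : UpperHalfPlane) : IsThetaTwo τ (thetaSqWp τ) where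
  differentiable := differentiable_thetaSqWp τ
  add_one := by
    have hc := (differentiable_thetaSqWp τ).continuous
    refine eq_of_eq_off_lattice (τ := τ) (by fun_prop) hc fun v hv => ?_
    have h1 : v + 1 ∉ (periods τ).lattice := fun h => hv <| by
      simpa using sub_mem h (one_mem_lattice τ)
    rw [thetaSqWp_of_notMem hv, thetaSqWp_of_notMem h1, (isThetaTwo_sq τ).add_one v,
      wp_add_mem (one_mem_lattice τ)]
  add_tau := by
    have hc := (differentiable_thetaSqWp τ).continuous
    refine eq_of_eq_off_lattice (τ := τ) (by fun_prop) (by fun_prop) fun v hv => ?_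
    have h1 : v + τ ∉ (periods τ).lattice := fun h => hv <| by
      simpa using sub_mem h (tau_mem_lattice τ)
    rw [thetaSqWp_of_notMem hv, thetaSqWp_of_notMem h1, (isThetaTwo_sq τ).add_tau v,
      wp_add_mem (tau_mem_lattice τ), mul_assoc]

/-- Three functions and two functionals (the Fourier coefficients of index `0` and `1`) give a
nontrivial combination killed by both, to which `quasiperiodic_eq_zero` applies. -/
lemma IsThetaTwo.exists_relation {τ : UpperHalfPlane} {f g h : ℂ → ℂ} (hf : IsThetaTwo τ f)
    (hg : IsThetaTwo τ g) (hh : IsThetaTwo τ h) :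
    ∃ x y w : ℂ, (x ≠ 0 ∨ y ≠ 0 ∨ w ≠ 0) ∧ ∀ v, x * f v + y * g v + w * h v = 0 := by
  set A : (ℂ → ℂ) → ℂ := fun f => ∫ x : ℝ in (0 : ℝ)..1, f x with hA
  set B : (ℂ → ℂ) → ℂ := fun f => ∫ x : ℝ in (0 : ℝ)..1, cexp (-(2 * Real.pi * I * x)) * f x with hB
  let M : Matrix (Fin 2) (Fin 3) ℂ := !![A f, A g, A h; B f, B g, B h]
  have hker : M.mulVecLin.ker ≠ ⊥ := LinearMap.ker_ne_bot_of_finrank_lt (by simp)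
  obtain ⟨u, hu, hu0⟩ := Submodule.exists_mem_ne_zero_of_ne_bot hker
  have hu' : M.mulVec u = 0 := hu
  have e0 : A f * u 0 + A g * u 1 + A h * u 2 = 0 := by
    simpa [M, Matrix.mulVec, dotProduct, Fin.sum_univ_three] using congrFun hu' 0
  have e1 : B f * u 0 + B g * u 1 + B h * u 2 = 0 := by
    simpa [M, Matrix.mulVec, dotProduct, Fin.sum_univ_three] using congrFun hu' 1
  have df := hf.differentiable
  have dg := hg.differentiable
  have dh := hh.differentiable
  have cf := df.continuous
  have cg := dg.continuous
  have ch := dh.continuous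
  refine ⟨u 0, u 1, u 2, ?_, quasiperiodic_eq_zero (τ := τ) (by fun_prop)
    (fun v => by rw [hf.add_one, hg.add_one, hh.add_one])
    (fun v => by rw [hf.add_tau, hg.add_tau, hh.add_tau]; ring) ?_ ?_⟩
  · by_contra! hz
    refine hu0 (funext fun i => ?_)
    fin_cases i
    exacts [hz.1, hz.2.1, hz.2.2]
  · rw [intervalIntegral.integral_add, intervalIntegral.integral_add,
      intervalIntegral.integral_const_mul, intervalIntegral.integral_const_mul,
      intervalIntegral.integral_const_mul]
    · linear_combination e0
    all_goals exact Continuous.intervalIntegrable (by fun_prop) _ _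
  · simp_rw [mul_add, mul_left_comm (cexp _)]
    rw [intervalIntegral.integral_add, intervalIntegral.integral_add,
      intervalIntegral.integral_const_mul, intervalIntegral.integral_const_mul,
      intervalIntegral.integral_const_mul]
    · linear_combination e1
    all_goals exact Continuous.intervalIntegrable (by fun_prop) _ _

/-- `1` and `℘` are linearly independent near the pole. -/
lemma eq_zero_of_add_mul_wp {τ : UpperHalfPlane} {x y : ℂ}
    (h : ∀ᶠ v in 𝓝[≠] (0 : ℂ), x + y * wp τ v = 0) : x = 0 ∧ y = 0 := by
  obtain ⟨g, hg, hg0, hgw⟩ := exists_analyticAt_sq_mul_wp τ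
  have ht : Tendsto (fun v => x * v ^ 2 + y * g v) (𝓝[≠] 0) (𝓝 (x * 0 ^ 2 + y * g 0)) := by
    have := hg.continuousAt
    exact (ContinuousAt.tendsto (by fun_prop)).mono_left nhdsWithin_le_nhds
  have ht' : Tendsto (fun v => x * v ^ 2 + y * g v) (𝓝[≠] 0) (𝓝 0) := by
    refine tendsto_const_nhds.congr' ?_
    filter_upwards [h, self_mem_nhdsWithin] with v hv hv0
    rw [hgw v hv0]
    linear_combination -v ^ 2 * hv
  have hy : y = 0 := by simpa [hg0] using tendsto_nhds_unique ht ht'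
  subst hy
  obtain ⟨v, hv⟩ := h.exists
  exact ⟨by simpa using hv, rfl⟩

lemma exists_theta_relation (τ : UpperHalfPlane) (c : ℂ) : ∃ x y : ℂ, ∀ v,
    theta1 τ (v - c) * theta1 τ (v + c) = x * theta1 τ v ^ 2 + y * thetaSqWp τ v := by
  obtain ⟨x, y, w, hne, h⟩ :=
    (isThetaTwo_sq τ).exists_relation (isThetaTwo_thetaSqWp τ) (isThetaTwo_mul τ c)
  -- Without the third function the relation would make `1` and `℘` linearly dependent.
  have hw : w ≠ 0 := by
    rintro rfl
    have h0 : ∀ᶠ v in 𝓝[≠] (0 : ℂ), x + y * wp τ v = 0 := by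
      filter_upwards [eventually_notMem_lattice τ 0, eventually_theta1_ne_zero τ 0] with v hv hv'
      have := h v
      rw [thetaSqWp_of_notMem hv] at this
      have h2 : theta1 τ v ^ 2 * (x + y * wp τ v) = 0 := by linear_combination this
      exact (mul_eq_zero.1 h2).resolve_left (pow_ne_zero 2 hv')
    have := eq_zero_of_add_mul_wp h0
    simp [this.1, this.2] at hne
  refine ⟨-x / w, -y / w, fun v => ?_⟩
  field_simp
  linear_combination h v

/-- At `v = 0` the relation reads `-θ₁(c)² = y θ₁'(0)²`; if `θ₁'(0)` were zero, `θ₁` would vanish at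
every `c`. -/
lemma deriv_theta1_zero_ne_zero (τ : UpperHalfPlane) : deriv (theta1 τ) 0 ≠ 0 := by
  intro hk
  obtain ⟨c, hc⟩ := exists_theta1_ne_zero τ
  obtain ⟨x, y, h⟩ := exists_theta_relation τ c
  have := h 0
  rw [thetaSqWp_zero, hk, theta1_zero, zero_sub, zero_add, theta1_neg] at this
  apply hc
  have h2 : theta1 τ c ^ 2 = 0 := by linear_combination -this
  exact pow_eq_zero_iff two_ne_zero |>.1 h2

/-- The two coefficients of `exists_theta_relation` are found by evaluating at `v = 0` and `v = c`.
-/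
lemma theta1_mul_aux {τ : UpperHalfPlane} {c : ℂ} (hc : c ∉ (periods τ).lattice)
    (hc0 : theta1 τ c ≠ 0) (v : ℂ) :
    deriv (theta1 τ) 0 ^ 2 * (theta1 τ (v - c) * theta1 τ (v + c)) =
      theta1 τ c ^ 2 * (theta1 τ v ^ 2 * wp τ c - thetaSqWp τ v) := by
  obtain ⟨x, y, h⟩ := exists_theta_relation τ c
  have h0 := h 0
  rw [thetaSqWp_zero, theta1_zero, zero_sub, zero_add, theta1_neg] at h0
  have h1 := h c
  rw [thetaSqWp_of_notMem hc, sub_self, theta1_zero, zero_mul] at h1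
  have h2 : x + y * wp τ c = 0 := by
    have : theta1 τ c ^ 2 * (x + y * wp τ c) = 0 := by linear_combination -h1
    exact (mul_eq_zero.1 this).resolve_left (pow_ne_zero 2 hc0)
  rw [h v]
  linear_combination deriv (theta1 τ) 0 ^ 2 * theta1 τ v ^ 2 * h2 +
    (thetaSqWp τ v - theta1 τ v ^ 2 * wp τ c) * (-h0)

/-- Zeros of `θ₁` are isolated, so `theta1_mul_aux` holds near `c` and passes to the limit at `c`. A
zero there would make `θ₁(v - c) θ₁(v + c)` vanish for all `v`, against isolation again. -/
lemma theta1_ne_zero {τ : UpperHalfPlane} {c : ℂ} (hc : c ∉ (periods τ).lattice) :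
    theta1 τ c ≠ 0 := by
  intro h0
  have hd := (differentiable_theta1 τ).continuous
  have key : ∀ v, theta1 τ (v - c) * theta1 τ (v + c) = 0 := by
    intro v
    have hw : ContinuousAt (wp τ) c := (analyticAt_wp hc).continuousAt
    have t1 : Tendsto (fun c => deriv (theta1 τ) 0 ^ 2 * (theta1 τ (v - c) * theta1 τ (v + c)))
        (𝓝[≠] c) (𝓝 (deriv (theta1 τ) 0 ^ 2 * (theta1 τ (v - c) * theta1 τ (v + c)))) :=
      (Continuous.tendsto (by fun_prop) c).mono_left nhdsWithin_le_nhds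
    have t2 : Tendsto (fun c => theta1 τ c ^ 2 * (theta1 τ v ^ 2 * wp τ c - thetaSqWp τ v))
        (𝓝[≠] c) (𝓝 (theta1 τ c ^ 2 * (theta1 τ v ^ 2 * wp τ c - thetaSqWp τ v))) := by
      have : ContinuousAt (fun c => theta1 τ c ^ 2 *
        (theta1 τ v ^ 2 * wp τ c - thetaSqWp τ v)) c := by fun_prop
      exact this.tendsto.mono_left nhdsWithin_le_nhds
    have e := tendsto_nhds_unique (t1.congr' ?_) t2
    · rw [h0, zero_pow two_ne_zero, zero_mul] at e
      exact (mul_eq_zero.1 e).resolve_left (pow_ne_zero 2 (deriv_theta1_zero_ne_zero τ))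
    · filter_upwards [eventually_notMem_lattice τ c, eventually_theta1_ne_zero τ c] with d h1 h2
      exact theta1_mul_aux h1 h2 v
  have t1 : Tendsto (fun v => v - c) (𝓝[≠] 0) (𝓝[≠] (0 - c)) :=
    tendsto_nhdsWithin_iff.2 ⟨(Continuous.tendsto (by fun_prop) _).mono_left nhdsWithin_le_nhds, by
      filter_upwards [self_mem_nhdsWithin] with v hv using by simpa [sub_left_inj] using hv⟩
  have t2 : Tendsto (fun v => v + c) (𝓝[≠] 0) (𝓝[≠] (0 + c)) :=
    tendsto_nhdsWithin_iff.2 ⟨(Continuous.tendsto (by fun_prop) _).mono_left nhdsWithin_le_nhds, by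
      filter_upwards [self_mem_nhdsWithin] with v hv using by simpa using hv⟩
  obtain ⟨v, h1, h2⟩ := ((t1.eventually (eventually_theta1_ne_zero τ _)).and
    (t2.eventually (eventually_theta1_ne_zero τ _))).exists
  exact mul_ne_zero h1 h2 (key v)

lemma theta1_eq_zero_iff {τ : UpperHalfPlane} {c : ℂ} :
    theta1 τ c = 0 ↔ c ∈ (periods τ).lattice :=
  ⟨fun h => by_contra fun hc => theta1_ne_zero hc h, theta1_eq_zero_of_mem⟩

lemma wp_sub_wp {τ : UpperHalfPlane} {v c : ℂ} (hv : v ∉ (periods τ).lattice)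
    (hc : c ∉ (periods τ).lattice) :
    wp τ c - wp τ v = deriv (theta1 τ) 0 ^ 2 * (theta1 τ (v - c) * theta1 τ (v + c)) /
      (theta1 τ c ^ 2 * theta1 τ v ^ 2) := by
  have h1 := theta1_ne_zero hv
  have h2 := theta1_ne_zero hc
  rw [theta1_mul_aux hc h2, thetaSqWp_of_notMem hv]
  field_simp

lemma wp_eq_wp_iff {τ : UpperHalfPlane} {v c : ℂ} (hv : v ∉ (periods τ).lattice)
    (hc : c ∉ (periods τ).lattice) :
    wp τ v = wp τ c ↔ v - c ∈ (periods τ).lattice ∨ v + c ∈ (periods τ).lattice := by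
  have h1 := theta1_ne_zero hv
  have h2 := theta1_ne_zero hc
  have hk := deriv_theta1_zero_ne_zero τ
  rw [eq_comm, ← sub_eq_zero, wp_sub_wp hv hc, ← theta1_eq_zero_iff, ← theta1_eq_zero_iff]
  simp [h1, h2, hk]

/-- The derivative `℘'`. -/
noncomputable def dwp (τ : UpperHalfPlane) (v : ℂ) : ℂ := (periods τ).derivWeierstrassP v

lemma deriv_wp (τ : UpperHalfPlane) : deriv (wp τ) = dwp τ := (periods τ).deriv_weierstrassP

lemma hasDerivAt_wp {τ : UpperHalfPlane} {v : ℂ} (hv : v ∉ (periods τ).lattice) :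
    HasDerivAt (wp τ) (dwp τ v) v := by
  rw [← deriv_wp]
  exact (analyticAt_wp hv).differentiableAt.hasDerivAt

lemma analyticAt_dwp {τ : UpperHalfPlane} {v : ℂ} (hv : v ∉ (periods τ).lattice) :
    AnalyticAt ℂ (dwp τ) v :=
  (periods τ).analyticOnNhd_derivWeierstrassP v hv

lemma dwp_neg (τ : UpperHalfPlane) (v : ℂ) : dwp τ (-v) = -dwp τ v :=
  (periods τ).derivWeierstrassP_neg v

lemma dwp_add_mem {τ : UpperHalfPlane} {l : ℂ} (hl : l ∈ (periods τ).lattice) (v : ℂ) :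
    dwp τ (v + l) = dwp τ v :=
  (periods τ).derivWeierstrassP_add_coe v ⟨l, hl⟩

lemma dwp_of_two_mul_mem {τ : UpperHalfPlane} {c : ℂ} (hc : 2 * c ∈ (periods τ).lattice) :
    dwp τ c = 0 := by
  have h := dwp_add_mem hc (-c)
  rw [show -c + 2 * c = c by ring, dwp_neg] at h
  linear_combination h / 2

lemma dwp_eq_zero_iff {τ : UpperHalfPlane} {c : ℂ} (hc : c ∉ (periods τ).lattice) :
    dwp τ c = 0 ↔ 2 * c ∈ (periods τ).lattice := by
  refine ⟨fun h0 => by_contra fun h2 => ?_, dwp_of_two_mul_mem⟩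
  have hk := deriv_theta1_zero_ne_zero τ
  have hθ := theta1_ne_zero hc
  have hθ2 := theta1_ne_zero h2
  have h1 : HasDerivAt (fun v => wp τ c - wp τ v) 0 c := by
    have := (hasDerivAt_wp hc).const_sub (wp τ c)
    rwa [h0, neg_zero] at this
  have d1 : HasDerivAt (fun v => theta1 τ (v - c)) (deriv (theta1 τ) 0) c := by
    have := ((differentiable_theta1 τ) (c - c)).hasDerivAt
    have := HasDerivAt.comp_sub_const c c this
    rwa [sub_self] at this
  have d2 : DifferentiableAt ℂ (fun v => deriv (theta1 τ) 0 ^ 2 * theta1 τ (v + c) /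
      (theta1 τ c ^ 2 * theta1 τ v ^ 2)) c := by
    have := differentiable_theta1 τ
    refine DifferentiableAt.div (by fun_prop) (by fun_prop) ?_
    positivity
  -- In the product formula `θ₁(v - c)` has a simple zero at `c`, and its cofactor at `c` contains
  -- `θ₁(2c)`, nonzero when `2c` is not a period.
  have h3 := d1.mul d2.hasDerivAt
  have h4 := (h1.congr_of_eventuallyEq (f₁ := fun v => theta1 τ (v - c) *
    (deriv (theta1 τ) 0 ^ 2 * theta1 τ (v + c) / (theta1 τ c ^ 2 * theta1 τ v ^ 2))) (by
      filter_upwards [(isOpen_compl_lattice τ).mem_nhds hc] with v hv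
      rw [wp_sub_wp hv hc]
      ring)).unique h3
  rw [sub_self, theta1_zero, zero_mul, add_zero, ← two_mul, eq_comm] at h4
  have : deriv (theta1 τ) 0 * (deriv (theta1 τ) 0 ^ 2 * theta1 τ (2 * c) /
    (theta1 τ c ^ 2 * theta1 τ c ^ 2)) ≠ 0 := by positivity
  exact this h4

end GenusOneTorsion

/-! ### Elliptic functions as polynomials in `℘` and `℘'`. -/

namespace GenusOneTorsion

open Complex Filter Topology Polynomial

lemma exists_analyticAt_eq_mul {f : ℂ → ℂ} (hf : AnalyticAt ℂ f 0) (h0 : f 0 = 0) :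
    ∃ g : ℂ → ℂ, AnalyticAt ℂ g 0 ∧ g 0 = deriv f 0 ∧ ∀ v, f v = v * g v := by
  obtain ⟨p, hp⟩ := hf
  refine ⟨dslope f 0, ⟨_, hp.has_fpower_series_dslope_fslope⟩, dslope_same f 0, fun v => ?_⟩
  simpa [h0] using (sub_smul_dslope f 0 v).symm

/-- Functions that are analytic off the lattice and periodic there. -/
structure IsElliptic (τ : UpperHalfPlane) (f : ℂ → ℂ) : Prop where
  analyticAt : ∀ v ∉ (periods τ).lattice, AnalyticAt ℂ f v
  add_mem : ∀ l ∈ (periods τ).lattice, ∀ v ∉ (periods τ).lattice, f (v + l) = f v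

variable {τ : UpperHalfPlane} {f g : ℂ → ℂ}

lemma isElliptic_wp (τ : UpperHalfPlane) : IsElliptic τ (wp τ) :=
  ⟨fun _ hv => analyticAt_wp hv, fun _ hl v _ => wp_add_mem hl v⟩

lemma isElliptic_dwp (τ : UpperHalfPlane) : IsElliptic τ (dwp τ) :=
  ⟨fun _ hv => analyticAt_dwp hv, fun _ hl v _ => dwp_add_mem hl v⟩

lemma IsElliptic.add (hf : IsElliptic τ f) (hg : IsElliptic τ g) :
    IsElliptic τ (fun v => f v + g v) :=
  ⟨fun v hv => (hf.1 v hv).add (hg.1 v hv), fun l hl v hv => by rw [hf.2 l hl v hv, hg.2 l hl v hv]⟩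

lemma IsElliptic.sub (hf : IsElliptic τ f) (hg : IsElliptic τ g) :
    IsElliptic τ (fun v => f v - g v) :=
  ⟨fun v hv => (hf.1 v hv).sub (hg.1 v hv), fun l hl v hv => by rw [hf.2 l hl v hv, hg.2 l hl v hv]⟩

lemma IsElliptic.mul (hf : IsElliptic τ f) (hg : IsElliptic τ g) :
    IsElliptic τ (fun v => f v * g v) :=
  ⟨fun v hv => (hf.1 v hv).mul (hg.1 v hv), fun l hl v hv => by rw [hf.2 l hl v hv, hg.2 l hl v hv]⟩

lemma IsElliptic.const_mul (hf : IsElliptic τ f) (c : ℂ) : IsElliptic τ (fun v => c * f v) :=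
  ⟨fun v hv => analyticAt_const.mul (hf.1 v hv), fun l hl v hv => by rw [hf.2 l hl v hv]⟩

lemma IsElliptic.pow (hf : IsElliptic τ f) (n : ℕ) : IsElliptic τ (fun v => f v ^ n) :=
  ⟨fun v hv => (hf.1 v hv).pow n, fun l hl v hv => by rw [hf.2 l hl v hv]⟩

lemma IsElliptic.comp_neg (hf : IsElliptic τ f) : IsElliptic τ (fun v => f (-v)) := by
  refine ⟨fun v hv => ?_, fun l hl v hv => ?_⟩
  · have h : -v ∉ (periods τ).lattice := by simpa using hv
    exact AnalyticAt.comp (g := f) (f := fun v => -v) (hf.1 _ h) (by fun_prop)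
  · rw [neg_add, hf.2 _ (neg_mem hl) _ (by simpa using hv)]

/-- Liouville: an elliptic function without poles is constant. -/
lemma IsElliptic.eq_const (hf : IsElliptic τ f) (hg : AnalyticAt ℂ g 0)
    (hfg : ∀ᶠ v in 𝓝[≠] 0, f v = g v) : ∀ v ∉ (periods τ).lattice, f v = g 0 := by
  classical
  set F : ℂ → ℂ := fun v => if v ∈ (periods τ).lattice then g 0 else f v with hF
  have hadd : ∀ l ∈ (periods τ).lattice, ∀ v, F (v + l) = F v := by
    intro l hl v
    by_cases hv : v ∈ (periods τ).lattice
    · simp [hF, hv, Submodule.add_mem _ hv hl]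
    · have : v + l ∉ (periods τ).lattice := fun h => hv (by simpa using sub_mem h hl)
      simp [hF, hv, this, hf.2 l hl v hv]
  have h0 : DifferentiableAt ℂ F 0 := by
    refine hg.differentiableAt.congr_of_eventuallyEq ?_
    have h1 := hfg.and (eventually_notMem_lattice τ 0)
    rw [eventually_nhdsWithin_iff] at h1
    filter_upwards [h1] with v hv
    by_cases hv0 : v = 0
    · simp [hF, hv0]
    · obtain ⟨h2, h3⟩ := hv hv0
      simp [hF, h3, h2]
  have hd : Differentiable ℂ F := by
    intro v
    by_cases hv : v ∈ (periods τ).lattice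
    · have h1 : F = fun u => F (u - v) := funext fun u => by
        rw [← hadd v hv (u - v), sub_add_cancel]
      rw [h1]
      exact DifferentiableAt.comp (g := F) v (by simpa using h0) (by fun_prop)
    · refine (hf.1 v hv).differentiableAt.congr_of_eventuallyEq ?_
      filter_upwards [(isOpen_compl_lattice τ).mem_nhds hv] with u hu
      exact if_neg hu
  have hb : Bornology.IsBounded (Set.range F) := by
    have hK : IsCompact ((fun p : ℝ × ℝ => F (p.1 + p.2 * τ)) ''
        (Set.Icc (0 : ℝ) 1 ×ˢ Set.Icc (0 : ℝ) 1)) := by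
      refine (isCompact_Icc.prod isCompact_Icc).image ?_
      have := hd.continuous
      fun_prop
    refine hK.isBounded.subset ?_
    rintro _ ⟨v, rfl⟩
    set y : ℝ := v.im / τ.im with hy
    set x : ℝ := v.re - y * τ.re with hx
    have hv : v = (x : ℂ) + y * τ := by
      apply Complex.ext
      · simp [hx]
      · have := τ.im_ne_zero
        simp [hy, this]
    refine ⟨(Int.fract x, Int.fract y), ⟨⟨Int.fract_nonneg _, (Int.fract_lt_one _).le⟩,
      ⟨Int.fract_nonneg _, (Int.fract_lt_one _).le⟩⟩, ?_⟩
    have hm : ((⌊x⌋ : ℤ) : ℂ) + (⌊y⌋ : ℤ) * τ ∈ (periods τ).lattice :=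
      mem_lattice_iff.2 ⟨_, _, rfl⟩
    have hx' : ((Int.fract x : ℝ) : ℂ) = x - (⌊x⌋ : ℤ) := by
      rw [← Int.self_sub_floor]; push_cast; rfl
    have hy' : ((Int.fract y : ℝ) : ℂ) = y - (⌊y⌋ : ℤ) := by
      rw [← Int.self_sub_floor]; push_cast; rfl
    simp only
    rw [← hadd _ hm, hx', hy', hv]
    congr 1
    ring
  intro v hv
  have := hd.apply_eq_apply_of_bounded hb v 0
  simpa [hF, hv] using this

/-- An even elliptic function with poles only on the lattice is a polynomial in `℘`. -/
lemma IsElliptic.exists_polynomial (n : ℕ) (hf : IsElliptic τ f)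
    (heven : ∀ v ∉ (periods τ).lattice, f (-v) = f v) (hg : AnalyticAt ℂ g 0)
    (hfg : ∀ᶠ v in 𝓝[≠] 0, v ^ (2 * n) * f v = g v) :
    ∃ Q : ℂ[X], Q.natDegree ≤ n ∧ Q.coeff n = g 0 ∧
      ∀ v ∉ (periods τ).lattice, f v = Q.eval (wp τ v) := by
  induction n generalizing f g with
  | zero =>
    refine ⟨C (g 0), by simp, by simp, fun v hv => ?_⟩
    rw [eval_C]
    exact hf.eq_const hg (by simpa using hfg) v hv
  | succ n ih =>
    obtain ⟨w, hw, hw0, hww⟩ := exists_analyticAt_sq_mul_wp τ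
    -- Subtracting `g 0 * ℘ ^ (n + 1)` cancels the leading pole. What remains is even, so `h`
    -- vanishes to second order and the order of the pole drops by two.
    set h : ℂ → ℂ := fun v => g v - g 0 * w v ^ (n + 1) with hh
    have hha : AnalyticAt ℂ h 0 := by fun_prop
    have hfh : ∀ᶠ v in 𝓝[≠] 0, v ^ (2 * (n + 1)) * (f v - g 0 * wp τ v ^ (n + 1)) = h v := by
      filter_upwards [hfg, self_mem_nhdsWithin] with v hv hv0
      rw [hh]
      simp only
      rw [← hv, hww v hv0, mul_pow, ← pow_mul]
      ring
    have hneg : Tendsto (fun v : ℂ => -v) (𝓝[≠] 0) (𝓝[≠] 0) :=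
      tendsto_nhdsWithin_iff.2 ⟨by
        have : Tendsto (fun v : ℂ => -v) (𝓝 0) (𝓝 (-0)) := continuous_neg.tendsto 0
        simpa using this.mono_left nhdsWithin_le_nhds, by
        filter_upwards [self_mem_nhdsWithin] with v hv using by simpa using hv⟩
    have hheven : (fun v => h (-v)) =ᶠ[𝓝 0] h := by
      have h1 : ∀ᶠ v in 𝓝[≠] 0, h (-v) = h v := by
        filter_upwards [hfh, hneg.eventually hfh, eventually_notMem_lattice τ 0] with v h1 h2 h3
        rw [← h1, ← h2, heven v h3, wp_neg, Even.neg_pow (even_two_mul _)]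
      rw [eventually_nhdsWithin_iff] at h1
      filter_upwards [h1] with v hv
      by_cases hv0 : v = 0
      · simp [hv0]
      · exact hv hv0
    have hd : deriv h 0 = 0 := by
      have := hheven.deriv_eq
      rw [deriv_comp_neg, neg_zero] at this
      linear_combination -this / 2
    obtain ⟨g1, hg1, hg10, hg1e⟩ := exists_analyticAt_eq_mul hha (by simp [hh, hw0])
    obtain ⟨g2, hg2, -, hg2e⟩ := exists_analyticAt_eq_mul hg1 (by rw [hg10, hd])
    obtain ⟨Q, hQ, -, hQe⟩ := ih (f := fun v => f v - g 0 * wp τ v ^ (n + 1)) (g := g2)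
      (hf.sub (((isElliptic_wp τ).pow (n + 1)).const_mul (g 0)))
      (fun v hv => by rw [heven v hv, wp_neg]) hg2 (by
        filter_upwards [hfh, self_mem_nhdsWithin] with v hv hv0
        rw [hg1e, hg2e] at hv
        have h2 : v ^ 2 ≠ 0 := pow_ne_zero 2 hv0
        apply mul_left_cancel₀ h2
        linear_combination hv)
    refine ⟨Q + C (g 0) * X ^ (n + 1), ?_, ?_, fun v hv => ?_⟩
    · exact (natDegree_add_le_of_degree_le (hQ.trans n.le_succ) (natDegree_C_mul_X_pow_le _ _))
    · rw [coeff_add, coeff_C_mul, coeff_X_pow_self, coeff_eq_zero_of_natDegree_lt (by omega)]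
      ring
    · rw [eval_add, eval_mul, eval_C, eval_pow, eval_X, ← hQe v hv]
      ring

/-- The roots of a nonzero polynomial are bounded, whereas `℘` is unbounded at its pole. -/
lemma polynomial_eq_zero_of_eval_wp {Q : ℂ[X]}
    (h : ∀ᶠ v in 𝓝[≠] (0 : ℂ), Q.eval (wp τ v) = 0) : Q = 0 := by
  by_contra hQ
  obtain ⟨w, hw, hw0, hww⟩ := exists_analyticAt_sq_mul_wp τ
  obtain ⟨B, hB⟩ := (Q.roots.toFinset.finite_toSet.image norm).bddAbove
  have h1 : Tendsto (fun v => ‖w v‖ - B * ‖v ^ 2‖) (𝓝[≠] 0) (𝓝 (‖w 0‖ - B * ‖(0 : ℂ) ^ 2‖)) := by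
    have := hw.continuousAt
    exact (ContinuousAt.tendsto (by fun_prop)).mono_left nhdsWithin_le_nhds
  have h2 := h1.eventually (lt_mem_nhds (a := 0) (by simp [hw0]))
  obtain ⟨v, hv1, hv2, hv3⟩ := (h.and (h2.and self_mem_nhdsWithin)).exists
  have h3 : ‖wp τ v‖ ≤ B := hB ⟨_, by simpa [hQ] using hv1, rfl⟩
  rw [hww v hv3, norm_mul] at hv2
  have := mul_le_mul_of_nonneg_left h3 (norm_nonneg (v ^ 2))
  linarith

lemma polynomial_eq_of_eval_wp {P Q : ℂ[X]}
    (h : ∀ v, v ∉ (periods τ).lattice → 2 * v ∉ (periods τ).lattice →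
      P.eval (wp τ v) = Q.eval (wp τ v)) : P = Q := by
  refine sub_eq_zero.1 (polynomial_eq_zero_of_eval_wp (τ := τ) ?_)
  have h2 : Tendsto (fun v : ℂ => 2 * v) (𝓝[≠] 0) (𝓝[≠] 0) :=
    tendsto_nhdsWithin_iff.2 ⟨by
      have : Tendsto (fun v : ℂ => 2 * v) (𝓝 0) (𝓝 (2 * 0)) := Continuous.tendsto (by fun_prop) 0
      simpa using this.mono_left nhdsWithin_le_nhds, by
      filter_upwards [self_mem_nhdsWithin] with v hv using by simpa using hv⟩
  filter_upwards [eventually_notMem_lattice τ 0, h2.eventually (eventually_notMem_lattice τ 0)]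
    with v h3 h4
  rw [eval_sub, h v h3 h4, sub_self]

/-- A function analytic at `0` that extends `v³ ℘'(v)`. -/
lemma exists_analyticAt_cube_mul_dwp (τ : UpperHalfPlane) :
    ∃ g : ℂ → ℂ, AnalyticAt ℂ g 0 ∧ g 0 = -2 ∧ ∀ v, v ≠ 0 → g v = v ^ 3 * dwp τ v := by
  refine ⟨fun v => v ^ 3 * (periods τ).derivWeierstrassPExcept 0 v - 2, ?_, by simp, fun v hv => ?_⟩
  · have := (periods τ).analyticAt_derivWeierstrassPExcept 0
    fun_prop
  · have := (periods τ).derivWeierstrassPExcept_sub ⟨0, zero_mem _⟩ v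
    simp only [sub_zero] at this
    rw [dwp, ← this]
    field_simp

lemma exists_cubic (τ : UpperHalfPlane) : ∃ Q : ℂ[X], Q.natDegree ≤ 3 ∧ Q.coeff 3 = 4 ∧
    ∀ v ∉ (periods τ).lattice, dwp τ v ^ 2 = Q.eval (wp τ v) := by
  obtain ⟨w, hw, hw0, hww⟩ := exists_analyticAt_cube_mul_dwp τ
  have := IsElliptic.exists_polynomial 3 (g := fun v => w v ^ 2) ((isElliptic_dwp τ).pow 2)
    (fun v _ => by rw [dwp_neg, neg_sq]) (by fun_prop) (by
      filter_upwards [self_mem_nhdsWithin] with v hv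
      rw [hww v hv]; ring)
  obtain ⟨Q, h1, h2, h3⟩ := this
  exact ⟨Q, h1, by rw [h2, hw0]; norm_num, h3⟩

/-- The cubic polynomial `p` with `℘'² = p(℘)`. -/
noncomputable def cubic (τ : UpperHalfPlane) : ℂ[X] := (exists_cubic τ).choose

lemma natDegree_cubic (τ : UpperHalfPlane) : (cubic τ).natDegree = 3 :=
  le_antisymm (exists_cubic τ).choose_spec.1 (le_natDegree_of_ne_zero (by
    rw [cubic, (exists_cubic τ).choose_spec.2.1]; norm_num))

lemma coeff_cubic_three (τ : UpperHalfPlane) : (cubic τ).coeff 3 = 4 :=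
  (exists_cubic τ).choose_spec.2.1

lemma eval_cubic {v : ℂ} (hv : v ∉ (periods τ).lattice) :
    (cubic τ).eval (wp τ v) = dwp τ v ^ 2 :=
  ((exists_cubic τ).choose_spec.2.2 v hv).symm

/-- The nonzero half-periods. -/
noncomputable def halfPeriod (τ : UpperHalfPlane) : Fin 3 → ℂ := ![1 / 2, τ / 2, (1 + τ) / 2]

lemma ofInt_add_mul_tau_eq_zero {m n : ℤ} (h : (m : ℂ) + n * τ = 0) : m = 0 ∧ n = 0 := by
  have him := congrArg Complex.im h
  simp [τ.im_ne_zero] at him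
  subst him
  exact ⟨by simpa using h, rfl⟩

lemma div_two_mem_lattice_iff {m n : ℤ} :
    ((m : ℂ) + n * τ) / 2 ∈ (periods τ).lattice ↔ Even m ∧ Even n := by
  rw [mem_lattice_iff]
  constructor
  · rintro ⟨a, b, h⟩
    have h2 : ((2 * a - m : ℤ) : ℂ) + (2 * b - n : ℤ) * τ = 0 := by
      push_cast
      linear_combination 2 * h
    have := ofInt_add_mul_tau_eq_zero h2
    exact ⟨⟨a, by omega⟩, ⟨b, by omega⟩⟩
  · rintro ⟨⟨a, rfl⟩, ⟨b, rfl⟩⟩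
    exact ⟨a, b, by push_cast; ring⟩

lemma halfPeriod_notMem (τ : UpperHalfPlane) (i : Fin 3) :
    halfPeriod τ i ∉ (periods τ).lattice := by
  fin_cases i
  · simpa [halfPeriod] using (div_two_mem_lattice_iff (τ := τ) (m := 1) (n := 0)).not.2 (by decide)
  · simpa [halfPeriod] using (div_two_mem_lattice_iff (τ := τ) (m := 0) (n := 1)).not.2 (by decide)
  · simpa [halfPeriod] using (div_two_mem_lattice_iff (τ := τ) (m := 1) (n := 1)).not.2 (by decide)

lemma two_mul_halfPeriod_mem (τ : UpperHalfPlane) (i : Fin 3) :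
    2 * halfPeriod τ i ∈ (periods τ).lattice := by
  rw [mem_lattice_iff]
  fin_cases i
  · exact ⟨1, 0, by simp [halfPeriod]⟩
  · exact ⟨0, 1, by simp [halfPeriod]; ring⟩
  · exact ⟨1, 1, by simp [halfPeriod]; ring⟩

lemma wp_halfPeriod_injective (τ : UpperHalfPlane) :
    Function.Injective fun i => wp τ (halfPeriod τ i) := by
  intro i j hij
  by_contra hne
  have h := (wp_eq_wp_iff (halfPeriod_notMem τ i) (halfPeriod_notMem τ j)).1 hij
  have h' : halfPeriod τ i + halfPeriod τ j ∈ (periods τ).lattice := by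
    rcases h with h | h
    · have := add_mem h (two_mul_halfPeriod_mem τ j)
      rwa [show halfPeriod τ i - halfPeriod τ j + 2 * halfPeriod τ j =
        halfPeriod τ i + halfPeriod τ j by ring] at this
    · exact h
  have key : ∀ m n : ℤ, halfPeriod τ i + halfPeriod τ j = ((m : ℂ) + n * τ) / 2 →
      Even m ∧ Even n := fun m n e => div_two_mem_lattice_iff.1 (e ▸ h')
  fin_cases i <;> fin_cases j <;> first
    | exact hne rfl
    | exact absurd (key 1 1 (by simp [halfPeriod]; ring1)) (by decide)
    | exact absurd (key 2 1 (by simp [halfPeriod]; ring1)) (by decide)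
    | exact absurd (key 1 2 (by simp [halfPeriod]; ring1)) (by decide)

lemma cubic_ne_zero (τ : UpperHalfPlane) : cubic τ ≠ 0 := by
  intro h
  have := natDegree_cubic τ
  simp [h] at this

/-- The three half-period values are distinct roots of `p`, and the remainder of degree below three
vanishes at all of them. -/
lemma cubic_dvd {Q : ℂ[X]} (h : ∀ i, Q.eval (wp τ (halfPeriod τ i)) = 0) : cubic τ ∣ Q := by
  have hd := natDegree_cubic τ
  refine EuclideanDomain.mod_eq_zero.1 ?_
  refine eq_zero_of_natDegree_lt_card_of_eval_eq_zero _ (wp_halfPeriod_injective τ) (fun i => ?_) ?_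
  · have h1 := congrArg (eval (wp τ (halfPeriod τ i))) (EuclideanDomain.div_add_mod Q (cubic τ))
    rw [eval_add, eval_mul, eval_cubic (halfPeriod_notMem τ i),
      dwp_of_two_mul_mem (two_mul_halfPeriod_mem τ i), h i] at h1
    simpa using h1
  · have := natDegree_mod_lt Q (q := cubic τ) (by omega)
    rw [Fintype.card_fin]
    omega

/-- An odd elliptic function with poles only on the lattice is `℘'` times a polynomial in `℘`. -/
lemma IsElliptic.exists_polynomial_of_odd {m : ℕ} (hf : IsElliptic τ f)
    (hodd : ∀ v ∉ (periods τ).lattice, f (-v) = -f v) (hg : AnalyticAt ℂ g 0)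
    (hfg : ∀ᶠ v in 𝓝[≠] 0, v ^ (2 * m) * f v = g v) (hg0 : g 0 = 0) :
    ∃ Q : ℂ[X], (Q = 0 ∨ Q.natDegree + 2 ≤ m) ∧
      ∀ v ∉ (periods τ).lattice, f v = dwp τ v * Q.eval (wp τ v) := by
  obtain ⟨w, hw, hw0, hww⟩ := exists_analyticAt_cube_mul_dwp τ
  obtain ⟨g1, hg1, -, hg1e⟩ := exists_analyticAt_eq_mul hg hg0
  -- As `g 0 = 0`, `f` has a pole of order at most `2m - 1`. The even function `f ℘'` has order at
  -- most `2m + 2`, and dividing by the cubic `℘'²` leaves degree at most `m - 2`.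
  obtain ⟨Q, hQ, -, hQe⟩ := IsElliptic.exists_polynomial (m + 1) (g := fun v => g1 v * w v)
    (hf.mul (isElliptic_dwp τ)) (fun v hv => by rw [hodd v hv, dwp_neg, neg_mul_neg])
    (by fun_prop) (by
      filter_upwards [hfg, self_mem_nhdsWithin] with v hv hv0
      rw [hww v hv0]
      have : v ≠ 0 := hv0
      apply mul_left_cancel₀ this
      rw [hg1e] at hv
      linear_combination v ^ 3 * dwp τ v * hv)
  obtain ⟨q, rfl⟩ : cubic τ ∣ Q := cubic_dvd fun i => by
    rw [← hQe _ (halfPeriod_notMem τ i), dwp_of_two_mul_mem (two_mul_halfPeriod_mem τ i), mul_zero]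
  refine ⟨q, ?_, ?_⟩
  · by_cases hq : q = 0
    · exact Or.inl hq
    · rw [natDegree_mul (cubic_ne_zero τ) hq, natDegree_cubic] at hQ
      right; omega
  · have key : ∀ v, v ∉ (periods τ).lattice → 2 * v ∉ (periods τ).lattice →
        f v = dwp τ v * q.eval (wp τ v) := by
      intro v hv h2
      have h3 := hQe v hv
      rw [eval_mul, eval_cubic hv] at h3
      have h4 : dwp τ v ≠ 0 := (dwp_eq_zero_iff hv).not.2 h2
      apply mul_left_cancel₀ h4
      linear_combination h3
    intro v hv
    -- At a half-period `℘'` cannot be cancelled, but there oddness and periodicity force `f v = 0`.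
    by_cases h2 : 2 * v ∈ (periods τ).lattice
    · rw [dwp_of_two_mul_mem h2, zero_mul]
      have h3 := hf.2 _ h2 (-v) (by simpa using hv)
      rw [show -v + 2 * v = v by ring, hodd v hv] at h3
      linear_combination h3 / 2
    · exact key v hv h2

end GenusOneTorsion

/-! ### The Szegő kernel and the polynomial matrix `M`. -/

namespace GenusOneTorsion

open Complex Filter Topology Polynomial

/-- Functions that are analytic off the lattice, with multipliers `c` along `v ↦ v + 1` and `d`
along `v ↦ v + τ`. -/
structure HasMultipliers (τ : UpperHalfPlane) (c d : ℂ) (f : ℂ → ℂ) : Prop where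
  analyticAt : ∀ v ∉ (periods τ).lattice, AnalyticAt ℂ f v
  add_one : ∀ v, f (v + 1) = c * f v
  add_tau : ∀ v, f (v + τ) = d * f v

lemma HasMultipliers.deriv {τ : UpperHalfPlane} {c d : ℂ} {f : ℂ → ℂ}
    (hf : HasMultipliers τ c d f) : HasMultipliers τ c d (deriv f) where
  analyticAt v hv := (hf.analyticAt v hv).deriv
  add_one v := by
    rw [← deriv_comp_add_const, ← deriv_const_mul_field]
    simp_rw [hf.add_one]
  add_tau v := by
    rw [← deriv_comp_add_const, ← deriv_const_mul_field]
    simp_rw [hf.add_tau]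

lemma HasMultipliers.isElliptic {τ : UpperHalfPlane} {f : ℂ → ℂ}
    (hf : HasMultipliers τ 1 1 f) : IsElliptic τ f where
  analyticAt := hf.analyticAt
  add_mem _ hl v _ := periodic_of_add_one_of_add_tau (fun v => by rw [hf.add_one, one_mul])
    (fun v => by rw [hf.add_tau, one_mul]) hl v

lemma HasMultipliers.mul_comp_neg {τ : UpperHalfPlane} {c d : ℂ} {f g : ℂ → ℂ} (hf : HasMultipliers τ c d f) (hg : HasMultipliers τ c d g) :
    IsElliptic τ (fun v => f v * g (-v)) := by
  refine HasMultipliers.isElliptic ⟨fun v hv => ?_, fun v => ?_, fun v => ?_⟩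
  · have h : -v ∉ (periods τ).lattice := by simpa using hv
    exact (hf.analyticAt v hv).mul
      (AnalyticAt.comp (g := g) (f := fun v => -v) (hg.analyticAt _ h) (by fun_prop))
  · have h := hg.add_one (-(v + 1))
    rw [show -(v + 1) + 1 = -v by ring] at h
    rw [hf.add_one, h]; ring
  · have h := hg.add_tau (-(v + τ))
    rw [show -(v + τ) + τ = -v by ring] at h
    rw [hf.add_tau, h]; ring

/-- The Szegő kernel as a function of the difference `u = v - w`. -/
noncomputable def szegoFun (τ : UpperHalfPlane) (α β : ℝ) (u : ℂ) : ℂ := szego τ α β u 0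

section

variable {τ : UpperHalfPlane} {α β : ℝ}

lemma szego_eq (v w : ℂ) : szego τ α β v w = szegoFun τ α β (v - w) := by
  simp [szegoFun, szego]

lemma phi_zero (v : ℂ) : phi τ α β 0 v = szegoFun τ α β v := by
  simp [phi, szego_eq]

lemma phi_one (v : ℂ) : phi τ α β 1 v = -deriv (szegoFun τ α β) v := by
  simp only [phi, szego_eq, iteratedDeriv_one]
  rw [deriv_comp_const_sub, sub_zero]

lemma Psi0_eq (v : ℂ) : Psi0 τ α β v =
    !![szegoFun τ α β v, szegoFun τ α β (-v);
      -deriv (szegoFun τ α β) v, -deriv (szegoFun τ α β) (-v)] := by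
  simp [Psi0, phi_zero, phi_one]

lemma szegoFun_eq (u : ℂ) : szegoFun τ α β u = -(cexp (2 * Real.pi * I * α * u) *
    (deriv (theta1 τ) 0 * theta1 τ (u - charPoint τ α β)) /
      (theta1 τ (charPoint τ α β) * theta1 τ u)) := by
  simp only [szegoFun, szego, sub_zero, zero_sub, theta1_neg, mul_neg, div_neg]

lemma hasMultipliers_szegoFun (hX : theta1 τ (charPoint τ α β) ≠ 0) :
    HasMultipliers τ (cexp (2 * Real.pi * I * α)) (cexp (2 * Real.pi * I * β))
      (szegoFun τ α β) where
  analyticAt v hv := by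
    rw [funext szegoFun_eq]
    have h : ∀ v, AnalyticAt ℂ (theta1 τ) v := fun v => (differentiable_theta1 τ).analyticAt v
    have h1 : AnalyticAt ℂ (fun u => theta1 τ (u - charPoint τ α β)) v :=
      AnalyticAt.comp (g := theta1 τ) (f := fun u => u - charPoint τ α β) (h _) (by fun_prop)
    have h2 := h v
    have h3 := theta1_ne_zero hv
    refine AnalyticAt.neg (AnalyticAt.div (by fun_prop) (by fun_prop) (mul_ne_zero hX h3))
  add_one v := by
    rw [szegoFun_eq, szegoFun_eq, show v + 1 - charPoint τ α β = v - charPoint τ α β + 1 by ring,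
      theta1_add_one, theta1_add_one, mul_add, Complex.exp_add, mul_one]
    simp only [mul_neg, neg_div_neg_eq]
    ring
  add_tau v := by
    have key : cexp (2 * Real.pi * I * α * τ) *
        cexp (-Real.pi * I * (τ + 2 * (v - charPoint τ α β))) =
        cexp (2 * Real.pi * I * β) * cexp (-Real.pi * I * (τ + 2 * v)) := by
      rw [← Complex.exp_add, ← Complex.exp_add]
      congr 1
      unfold charPoint
      ring
    rw [szegoFun_eq, szegoFun_eq, show v + τ - charPoint τ α β = v - charPoint τ α β + τ by ring,
      theta1_add_tau, theta1_add_tau, mul_add, Complex.exp_add]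
    have h0 := Complex.exp_ne_zero (-Real.pi * I * (τ + 2 * v))
    generalize cexp (-Real.pi * I * (τ + 2 * v)) = e1 at *
    generalize cexp (-Real.pi * I * (τ + 2 * (v - charPoint τ α β))) = e2 at *
    by_cases hv : theta1 τ v = 0
    · simp [hv]
    · field_simp
      linear_combination -(deriv (theta1 τ) 0 * theta1 τ (v - charPoint τ α β)) * key

lemma szegoFun_mul_neg (hX : theta1 τ (charPoint τ α β) ≠ 0) {v : ℂ}
    (hv : v ∉ (periods τ).lattice) :
    szegoFun τ α β v * szegoFun τ α β (-v) = wp τ (charPoint τ α β) - wp τ v := by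
  have hX' : charPoint τ α β ∉ (periods τ).lattice := fun h => hX (theta1_eq_zero_of_mem h)
  have h3 := theta1_ne_zero hv
  have he : cexp (2 * Real.pi * I * α * v) * cexp (2 * Real.pi * I * α * -v) = 1 := by
    rw [← Complex.exp_add, mul_neg, add_neg_cancel, Complex.exp_zero]
  rw [wp_sub_wp hv hX', szegoFun_eq, szegoFun_eq, theta1_neg,
    show -v - charPoint τ α β = -(v + charPoint τ α β) by ring, theta1_neg]
  generalize cexp (2 * Real.pi * I * α * v) = e1 at *
  generalize cexp (2 * Real.pi * I * α * -v) = e2 at *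
  field_simp
  linear_combination deriv (theta1 τ) 0 ^ 2 * theta1 τ (v - charPoint τ α β) *
    theta1 τ (v + charPoint τ α β) * he

/-- This is the derivative of `szegoFun_mul_neg`; up to sign it is the determinant of `Ψ₀`. -/
lemma szegoFun_wronskian (hX : theta1 τ (charPoint τ α β) ≠ 0) {v : ℂ}
    (hv : v ∉ (periods τ).lattice) :
    deriv (szegoFun τ α β) v * szegoFun τ α β (-v) -
      szegoFun τ α β v * deriv (szegoFun τ α β) (-v) = -dwp τ v := by
  have hm := hasMultipliers_szegoFun hX
  have h1 := (hm.analyticAt v hv).differentiableAt.hasDerivAt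
  have h2 := (hm.analyticAt (-v) (by simpa using hv)).differentiableAt.hasDerivAt
  have h3 := h1.mul (h2.scomp v (hasDerivAt_neg v))
  have h4 := (hasDerivAt_wp hv).const_sub (wp τ (charPoint τ α β))
  have h5 := (h4.congr_of_eventuallyEq (by
    filter_upwards [(isOpen_compl_lattice τ).mem_nhds hv] with u hu
    exact szegoFun_mul_neg hX hu)).unique h3
  simp only [Function.comp, neg_smul, one_smul] at h5
  rw [h5]; ring

lemma exists_analyticAt_mul_szegoFun (hX : theta1 τ (charPoint τ α β) ≠ 0) :
    ∃ s : ℂ → ℂ, AnalyticAt ℂ s 0 ∧ s 0 = 1 ∧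
      ∀ᶠ v in 𝓝[≠] 0, v * szegoFun τ α β v = s v := by
  have h : ∀ v, AnalyticAt ℂ (theta1 τ) v := fun v => (differentiable_theta1 τ).analyticAt v
  have hk := deriv_theta1_zero_ne_zero τ
  obtain ⟨t, ht, ht0, hte⟩ := exists_analyticAt_eq_mul (h 0) (theta1_zero τ)
  refine ⟨fun u => -(cexp (2 * Real.pi * I * α * u) *
    (deriv (theta1 τ) 0 * theta1 τ (u - charPoint τ α β)) /
      (theta1 τ (charPoint τ α β) * t u)), ?_, ?_, ?_⟩
  · have h1 : AnalyticAt ℂ (fun u => theta1 τ (u - charPoint τ α β)) 0 :=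
      AnalyticAt.comp (g := theta1 τ) (f := fun u => u - charPoint τ α β) (h _) (by fun_prop)
    refine AnalyticAt.neg (AnalyticAt.div (by fun_prop) (by fun_prop) ?_)
    rw [ht0]
    exact mul_ne_zero hX hk
  · simp only [ht0, zero_sub, theta1_neg, mul_zero, Complex.exp_zero]
    field_simp
  · filter_upwards [self_mem_nhdsWithin] with v hv
    have hv : v ≠ 0 := hv
    rw [szegoFun_eq, hte v]
    field_simp

lemma tendsto_neg_nhdsNE_zero : Tendsto (fun v : ℂ => -v) (𝓝[≠] 0) (𝓝[≠] 0) :=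
  tendsto_nhdsWithin_iff.2 ⟨by
    have : Tendsto (fun v : ℂ => -v) (𝓝 0) (𝓝 (-0)) := continuous_neg.tendsto 0
    simpa using this.mono_left nhdsWithin_le_nhds, by
    filter_upwards [self_mem_nhdsWithin] with v hv using by simpa using hv⟩

lemma analyticAt_comp_neg_zero {s : ℂ → ℂ} (hs : AnalyticAt ℂ s 0) :
    AnalyticAt ℂ (fun v => s (-v)) 0 :=
  AnalyticAt.comp (g := s) (f := fun v => -v) (by simpa using hs) (by fun_prop)

lemma exists_analyticAt_sq_mul_deriv_szegoFun {f s : ℂ → ℂ} (hs : AnalyticAt ℂ s 0)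
    (hfs : ∀ᶠ v in 𝓝[≠] 0, v * f v = s v) :
    ∃ s1 : ℂ → ℂ, AnalyticAt ℂ s1 0 ∧ s1 0 = -s 0 ∧
      ∀ᶠ v in 𝓝[≠] 0, v ^ 2 * deriv f v = s1 v := by
  refine ⟨fun v => v * deriv s v - s v, ?_, by simp, ?_⟩
  · have := hs.deriv
    fun_prop
  · have h2 : ∀ᶠ v in 𝓝[≠] (0 : ℂ), f =ᶠ[𝓝 v] fun u => s u / u := by
      have := eventually_eventually_nhdsWithin.2 hfs
      filter_upwards [this, self_mem_nhdsWithin] with v hv hv0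
      rw [(isOpen_compl_singleton (x := (0 : ℂ))).nhdsWithin_eq hv0] at hv
      filter_upwards [hv, isOpen_compl_singleton.mem_nhds hv0] with u hu hu0
      have : u ≠ 0 := hu0
      field_simp
      linear_combination hu
    filter_upwards [h2, self_mem_nhdsWithin,
      nhdsWithin_le_nhds hs.eventually_analyticAt] with v hv hv0 hva
    have hv0 : v ≠ 0 := hv0
    rw [hv.deriv_eq, deriv_fun_div hva.differentiableAt differentiableAt_fun_id hv0]
    simp
    field_simp

/-- The diagonal entry of the polynomial matrix `℘' (2 Ψ₀ E₁₁ Ψ₀⁻¹ - 1)`. -/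
lemma exists_diagonal_entry (hX : theta1 τ (charPoint τ α β) ≠ 0) : ∃ Q : ℂ[X],
    Q.natDegree ≤ 1 ∧ ∀ v ∉ (periods τ).lattice,
      deriv (szegoFun τ α β) v * szegoFun τ α β (-v) +
        szegoFun τ α β v * deriv (szegoFun τ α β) (-v) = Q.eval (wp τ v) := by
  have hm := hasMultipliers_szegoFun hX
  have hm' := hm.deriv
  obtain ⟨s, hs, hs0, hse⟩ := exists_analyticAt_mul_szegoFun hX
  obtain ⟨s1, hs1, hs10, hs1e⟩ := exists_analyticAt_sq_mul_deriv_szegoFun hs hse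
  have hsn := analyticAt_comp_neg_zero hs
  have hs1n := analyticAt_comp_neg_zero hs1
  -- The pole has order at most three. Raising it to the even bound four introduces the factor `v`
  -- in `g`, which makes the coefficient of `X ^ 2` zero.
  obtain ⟨Q, h1, h2, h3⟩ := IsElliptic.exists_polynomial 2
    (g := fun v => v * (-(s1 v * s (-v)) + s v * s1 (-v)))
    ((hm'.mul_comp_neg hm).add
      (hm.mul_comp_neg hm'))
    (fun v _ => by rw [neg_neg]; ring)
    (analyticAt_id.mul ((hs1.mul hsn).neg.add (hs.mul hs1n))) (by
      filter_upwards [hse, hs1e, tendsto_neg_nhdsNE_zero.eventually hse,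
        tendsto_neg_nhdsNE_zero.eventually hs1e] with v e1 e2 e3 e4
      rw [← e1, ← e2, ← e3, ← e4]
      ring)
  refine ⟨Q, ?_, h3⟩
  rw [zero_mul] at h2
  by_contra hlt
  have h4 : Q.natDegree = 2 := by omega
  rw [← h4] at h2
  have : Q = 0 := leadingCoeff_eq_zero.1 h2
  simp [this] at h4

/-- The lower left entry of the polynomial matrix `℘' (2 Ψ₀ E₁₁ Ψ₀⁻¹ - 1)`. -/
lemma exists_lower_entry (hX : theta1 τ (charPoint τ α β) ≠ 0) : ∃ Q : ℂ[X],
    Q.natDegree ≤ 2 ∧ Q.coeff 2 = -2 ∧ ∀ v ∉ (periods τ).lattice,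
      -2 * (deriv (szegoFun τ α β) v * deriv (szegoFun τ α β) (-v)) = Q.eval (wp τ v) := by
  have hm' := (hasMultipliers_szegoFun hX).deriv
  obtain ⟨s, hs, hs0, hse⟩ := exists_analyticAt_mul_szegoFun hX
  obtain ⟨s1, hs1, hs10, hs1e⟩ := exists_analyticAt_sq_mul_deriv_szegoFun hs hse
  have hs1n := analyticAt_comp_neg_zero hs1
  obtain ⟨Q, h1, h2, h3⟩ := IsElliptic.exists_polynomial 2
    (g := fun v => -2 * (s1 v * s1 (-v)))
    ((hm'.mul_comp_neg hm').const_mul (-2))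
    (fun v _ => by rw [neg_neg]; ring) (analyticAt_const.mul (hs1.mul hs1n)) (by
      filter_upwards [hs1e, tendsto_neg_nhdsNE_zero.eventually hs1e] with v e2 e4
      rw [← e2, ← e4]
      ring)
  exact ⟨Q, h1, by rw [h2, neg_zero, hs10, hs0]; norm_num, h3⟩

end

/-- Split `diag(a, b)` as `(a + b)/2` times the identity plus `(a - b)/2` times `diag(1, -1)`;
conjugating the latter gives the matrix on the right divided by `d`. -/
lemma conj_diagonal {g h g' h' d a b : ℂ} (hd : d ≠ 0) (hw : g' * h - g * h' = -d) :
    !![g, h; -g', -h'] * !![a, 0; 0, b] * (!![g, h; -g', -h'])⁻¹ =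
      ((a + b) / 2) • (1 : Matrix (Fin 2) (Fin 2) ℂ) + ((a - b) / (2 * d)) •
        !![g' * h + g * h', 2 * (g * h); -2 * (g' * h'), -(g' * h + g * h')] := by
  have hdet : (!![g, h; -g', -h']).det = -d := by
    rw [Matrix.det_fin_two_of]; linear_combination hw
  have e : d = g * h' - g' * h := by linear_combination hw
  rw [Matrix.inv_def, hdet, Matrix.adjugate_fin_two_of, Ring.inverse_eq_inv']
  ext i j
  fin_cases i <;> fin_cases j <;>
    simp [Matrix.mul_apply, Fin.sum_univ_two] <;> field_simp <;> first | ring1 | (rw [e]; ring1)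

/-- The polynomial matrix `M` in `z = ℘(v)`, of square `p`, with `Ψ₀ E₁₁ Ψ₀⁻¹ = (1 + M / ℘') / 2`. -/
structure IsSpectralMatrix (τ : UpperHalfPlane) (α β : ℝ) (m₁ m₂ : ℂ[X]) : Prop where
  natDegree_fst : m₁.natDegree ≤ 1
  natDegree_snd : m₂.natDegree ≤ 2
  coeff_snd : m₂.coeff 2 = -2
  sq_eq : m₁ ^ 2 + (C 2 * (C (wp τ (charPoint τ α β)) - X)) * m₂ = cubic τ
  conj_eq : ∀ v, v ∉ (periods τ).lattice → 2 * v ∉ (periods τ).lattice → ∀ a b : ℂ,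
    Psi0 τ α β v * !![a, 0; 0, b] * (Psi0 τ α β v)⁻¹ =
      ((a + b) / 2) • (1 : Matrix (Fin 2) (Fin 2) ℂ) + ((a - b) / (2 * dwp τ v)) •
        !![m₁.eval (wp τ v), 2 * (wp τ (charPoint τ α β) - wp τ v);
          m₂.eval (wp τ v), -m₁.eval (wp τ v)]

lemma det_Psi0 {τ : UpperHalfPlane} {α β : ℝ} (hX : theta1 τ (charPoint τ α β) ≠ 0) {v : ℂ}
    (hv : v ∉ (periods τ).lattice) : (Psi0 τ α β v).det = -dwp τ v := by
  rw [Psi0_eq, Matrix.det_fin_two_of, ← szegoFun_wronskian hX hv]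
  ring

lemma exists_isSpectralMatrix {τ : UpperHalfPlane} {α β : ℝ}
    (hX : theta1 τ (charPoint τ α β) ≠ 0) : ∃ m₁ m₂ : ℂ[X], IsSpectralMatrix τ α β m₁ m₂ := by
  obtain ⟨m₁, h1, e1⟩ := exists_diagonal_entry hX
  obtain ⟨m₂, h2, h2', e2⟩ := exists_lower_entry hX
  refine ⟨m₁, m₂, h1, h2, h2', ?_, fun v hv hv2 a b => ?_⟩
  -- With `x = S'(v) S(-v)` and `y = S(v) S'(-v)` this is `(x + y)² - 4xy = (x - y)²`, the right
  -- side being the squared Wronskian `℘'²`.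
  · refine polynomial_eq_of_eval_wp (τ := τ) fun v hv _ => ?_
    simp only [eval_add, eval_mul, eval_pow, eval_sub, eval_C, eval_X]
    rw [eval_cubic hv, ← e1 v hv, ← e2 v hv, ← szegoFun_mul_neg hX hv, ← neg_sq (dwp τ v),
      ← szegoFun_wronskian hX hv]
    ring
  · rw [Psi0_eq, conj_diagonal ((dwp_eq_zero_iff hv).not.2 hv2) (szegoFun_wronskian hX hv),
      e1 v hv, e2 v hv, szegoFun_mul_neg hX hv]

/-- `p` vanishes at `℘(𝒳)` only if the square of the character is trivial. -/
lemma eval_cubic_charPoint_ne_zero {τ : UpperHalfPlane} {α β : ℝ}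
    (hX : theta1 τ (charPoint τ α β) ≠ 0) (h : ¬ ∃ m n : ℤ, 2 * α = m ∧ 2 * β = n) :
    (cubic τ).eval (wp τ (charPoint τ α β)) ≠ 0 := by
  have hX' : charPoint τ α β ∉ (periods τ).lattice := fun h => hX (theta1_eq_zero_of_mem h)
  rw [eval_cubic hX']
  refine pow_ne_zero 2 ((dwp_eq_zero_iff hX').not.2 fun hm => h ?_)
  obtain ⟨m, n, e⟩ := mem_lattice_iff.1 hm
  have him := congrArg Complex.im e
  have hre := congrArg Complex.re e
  have hτ := τ.im_ne_zero
  simp [charPoint] at him hre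
  have h1 : (n : ℝ) = -(2 * α) := by
    apply mul_right_cancel₀ hτ
    linear_combination him
  refine ⟨-n, m, by push_cast; linarith, ?_⟩
  rw [h1] at hre
  linear_combination -hre

end GenusOneTorsion

/-! ### The function `Y` and the Pell equation. -/

namespace GenusOneTorsion

open Complex Filter Topology Polynomial

variable {τ : UpperHalfPlane} {a b : ℤ} {R : ℕ}

lemma two_mul_torsionPt_notMem (hR : 0 < R) (hq : ¬ ((R : ℤ) ∣ a ∧ (R : ℤ) ∣ b)) :
    2 * torsionPt τ a b R ∉ (periods τ).lattice := by
  intro h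
  obtain ⟨m, n, e⟩ := mem_lattice_iff.1 h
  have hR' : (R : ℂ) ≠ 0 := by exact_mod_cast hR.ne'
  have h2 : ((R * m - b : ℤ) : ℂ) + (R * n - a : ℤ) * τ = 0 := by
    rw [torsionPt] at e
    field_simp at e
    push_cast
    linear_combination e
  have := ofInt_add_mul_tau_eq_zero h2
  exact hq ⟨⟨n, by linarith⟩, ⟨m, by linarith⟩⟩

lemma torsionPt_notMem (hR : 0 < R) (hq : ¬ ((R : ℤ) ∣ a ∧ (R : ℤ) ∣ b)) :
    torsionPt τ a b R ∉ (periods τ).lattice := fun h =>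
  two_mul_torsionPt_notMem hR hq (by rw [two_mul]; exact add_mem h h)

lemma Y_neg (v : ℂ) : Y τ a b R (-v) = (Y τ a b R v)⁻¹ := by
  unfold Y
  rw [← inv_pow, mul_inv, inv_div, ← Complex.exp_neg,
    show -v + torsionPt τ a b R = -(v - torsionPt τ a b R) by ring,
    show -v - torsionPt τ a b R = -(v + torsionPt τ a b R) by ring, theta1_neg, theta1_neg,
    neg_div_neg_eq, mul_neg]

lemma Y_ne_zero {v : ℂ} (h1 : v - torsionPt τ a b R ∉ (periods τ).lattice)
    (h2 : v + torsionPt τ a b R ∉ (periods τ).lattice) : Y τ a b R v ≠ 0 :=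
  pow_ne_zero _ (mul_ne_zero (Complex.exp_ne_zero _)
    (div_ne_zero (theta1_ne_zero h2) (theta1_ne_zero h1)))

/-- The `R`-th root of `(℘(v) - z_⋆)^R Y(v)`. -/
noncomputable def regRoot (τ : UpperHalfPlane) (a b : ℤ) (R : ℕ) (v : ℂ) : ℂ :=
  -(cexp (2 * Real.pi * I * (a / R) * v) * deriv (theta1 τ) 0 ^ 2 *
    theta1 τ (v + torsionPt τ a b R) ^ 2 / (theta1 τ v ^ 2 * theta1 τ (torsionPt τ a b R) ^ 2))

/-- The function `(℘(v) - z_⋆)^R Y(v)`, with poles on the lattice only. -/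
noncomputable def regY (τ : UpperHalfPlane) (a b : ℤ) (R : ℕ) (v : ℂ) : ℂ := regRoot τ a b R v ^ R

lemma regY_eq (hq : torsionPt τ a b R ∉ (periods τ).lattice) {v : ℂ}
    (hv : v ∉ (periods τ).lattice) (hvq : v - torsionPt τ a b R ∉ (periods τ).lattice) :
    regY τ a b R v = (wp τ v - zStar τ a b R) ^ R * Y τ a b R v := by
  have h1 := theta1_ne_zero hq
  have h2 := theta1_ne_zero hv
  have h3 := theta1_ne_zero hvq
  rw [regY, Y, ← mul_pow, zStar, ← neg_sub, wp_sub_wp hv hq, regRoot]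
  congr 1
  field_simp

lemma regY_mul_neg (hq : torsionPt τ a b R ∉ (periods τ).lattice) {v : ℂ}
    (hv : v ∉ (periods τ).lattice) :
    regY τ a b R v * regY τ a b R (-v) = (wp τ v - zStar τ a b R) ^ (2 * R) := by
  have h1 := theta1_ne_zero hq
  have h2 := theta1_ne_zero hv
  rw [regY, regY, pow_mul, ← mul_pow, zStar, ← neg_sub, wp_sub_wp hv hq, regRoot, regRoot,
    show -v + torsionPt τ a b R = -(v - torsionPt τ a b R) by ring, theta1_neg, theta1_neg]
  congr 1
  have he : cexp (2 * Real.pi * I * (a / R) * v) * cexp (2 * Real.pi * I * (a / R) * -v) = 1 := by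
    rw [← Complex.exp_add, mul_neg, add_neg_cancel, Complex.exp_zero]
  generalize cexp (2 * Real.pi * I * (a / R) * v) = e1 at *
  generalize cexp (2 * Real.pi * I * (a / R) * -v) = e2 at *
  field_simp
  linear_combination deriv (theta1 τ) 0 ^ 4 * theta1 τ (v - torsionPt τ a b R) ^ 2 *
    theta1 τ (v + torsionPt τ a b R) ^ 2 * he

/-- The root `regRoot` has multipliers `exp(2πia/R)` and `exp(-2πib/R)`, the second because `2Rq = b
+ aτ`. Both are `R`-th roots of unity and disappear in the power. -/
lemma isElliptic_regY (hR : 0 < R) (hq : torsionPt τ a b R ∉ (periods τ).lattice) :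
    IsElliptic τ (regY τ a b R) := by
  have hR' : (R : ℂ) ≠ 0 := by exact_mod_cast hR.ne'
  refine HasMultipliers.isElliptic ⟨fun v hv => ?_, fun v => ?_, fun v => ?_⟩
  · have h : ∀ v, AnalyticAt ℂ (theta1 τ) v := fun v => (differentiable_theta1 τ).analyticAt v
    have h1 : AnalyticAt ℂ (fun u => theta1 τ (u + torsionPt τ a b R)) v :=
      AnalyticAt.comp (g := theta1 τ) (f := fun u => u + torsionPt τ a b R) (h _) (by fun_prop)
    have h2 := h v
    refine AnalyticAt.pow (AnalyticAt.neg (AnalyticAt.div (by fun_prop) (by fun_prop) ?_)) R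
    exact mul_ne_zero (pow_ne_zero 2 (theta1_ne_zero hv)) (pow_ne_zero 2 (theta1_ne_zero hq))
  · have h : regRoot τ a b R (v + 1) = cexp (2 * Real.pi * I * (a / R)) * regRoot τ a b R v := by
      rw [regRoot, regRoot, show v + 1 + torsionPt τ a b R = v + torsionPt τ a b R + 1 by ring,
        theta1_add_one, theta1_add_one, mul_add, Complex.exp_add, mul_one]
      ring
    rw [regY, h, mul_pow, ← Complex.exp_nat_mul, show (R : ℂ) * (2 * Real.pi * I * (a / R)) =
      a * (2 * Real.pi * I) by field_simp, Complex.exp_int_mul_two_pi_mul_I, regY]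
  · have h : regRoot τ a b R (v + τ) = cexp (2 * Real.pi * I * (-b / R)) * regRoot τ a b R v := by
      have key : cexp (2 * Real.pi * I * (a / R) * τ) *
          cexp (-Real.pi * I * (τ + 2 * (v + torsionPt τ a b R))) ^ 2 =
          cexp (2 * Real.pi * I * (-b / R)) * cexp (-Real.pi * I * (τ + 2 * v)) ^ 2 := by
        rw [← Complex.exp_nat_mul, ← Complex.exp_nat_mul, ← Complex.exp_add, ← Complex.exp_add]
        congr 1
        rw [torsionPt]
        field_simp
        push_cast
        ring
      rw [regRoot, regRoot, show v + τ + torsionPt τ a b R = v + torsionPt τ a b R + τ by ring,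
        theta1_add_tau, theta1_add_tau, mul_add _ v, Complex.exp_add]
      have h0 := Complex.exp_ne_zero (-Real.pi * I * (τ + 2 * v))
      have h1 := theta1_ne_zero hq
      generalize cexp (-Real.pi * I * (τ + 2 * v)) = e1 at *
      generalize cexp (-Real.pi * I * (τ + 2 * (v + torsionPt τ a b R))) = e2 at *
      generalize cexp (2 * Real.pi * I * (a / R) * τ) = e3 at *
      generalize cexp (2 * Real.pi * I * (a / R) * v) = e4 at *
      generalize cexp (2 * Real.pi * I * (-b / R)) = e5 at *
      by_cases hv : theta1 τ v = 0
      · simp [hv]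
      · field_simp
        linear_combination
          -(e4 * deriv (theta1 τ) 0 ^ 2 * theta1 τ (v + torsionPt τ a b R) ^ 2) * key
    rw [regY, h, mul_pow, ← Complex.exp_nat_mul, show (R : ℂ) * (2 * Real.pi * I * (-b / R)) =
      ((-b : ℤ) : ℂ) * (2 * Real.pi * I) by push_cast; field_simp,
      Complex.exp_int_mul_two_pi_mul_I, regY]

lemma exists_analyticAt_regY (hq : torsionPt τ a b R ∉ (periods τ).lattice) :
    ∃ g : ℂ → ℂ, AnalyticAt ℂ g 0 ∧ g 0 = (-1) ^ R ∧
      ∀ v, v ≠ 0 → v ^ (2 * R) * regY τ a b R v = g v := by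
  have h : ∀ v, AnalyticAt ℂ (theta1 τ) v := fun v => (differentiable_theta1 τ).analyticAt v
  have hk := deriv_theta1_zero_ne_zero τ
  have hθ := theta1_ne_zero hq
  obtain ⟨t, ht, ht0, hte⟩ := exists_analyticAt_eq_mul (h 0) (theta1_zero τ)
  refine ⟨fun v => (-(cexp (2 * Real.pi * I * (a / R) * v) * deriv (theta1 τ) 0 ^ 2 *
    theta1 τ (v + torsionPt τ a b R) ^ 2 / (t v ^ 2 * theta1 τ (torsionPt τ a b R) ^ 2))) ^ R,
    ?_, ?_, fun v hv => ?_⟩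
  · have h1 : AnalyticAt ℂ (fun u => theta1 τ (u + torsionPt τ a b R)) 0 :=
      AnalyticAt.comp (g := theta1 τ) (f := fun u => u + torsionPt τ a b R) (h _) (by fun_prop)
    refine AnalyticAt.pow (AnalyticAt.neg (AnalyticAt.div (by fun_prop) (by fun_prop) ?_)) R
    rw [ht0]
    positivity
  · simp only [ht0, zero_add, mul_zero, Complex.exp_zero]
    congr 1
    field_simp
  · rw [regY, regRoot, hte v, pow_mul, ← mul_pow]
    congr 1
    field_simp

lemma regY_torsionPt_ne_zero (hq2 : 2 * torsionPt τ a b R ∉ (periods τ).lattice) :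
    regY τ a b R (torsionPt τ a b R) ≠ 0 := by
  have hq : torsionPt τ a b R ∉ (periods τ).lattice := fun h =>
    hq2 (by rw [two_mul]; exact add_mem h h)
  have hk := deriv_theta1_zero_ne_zero τ
  have hθ := theta1_ne_zero hq
  have hθ2 := theta1_ne_zero hq2
  rw [regY, regRoot, ← two_mul]
  refine pow_ne_zero R (neg_ne_zero.2 ?_)
  have := Complex.exp_ne_zero (2 * Real.pi * I * (a / R) * torsionPt τ a b R)
  positivity

/-- The polynomials `e`, `o` with `(z - z_⋆)^R Y(±v) = e(z) ∓ ℘'(v) o(z)`. -/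
structure IsPellPair (τ : UpperHalfPlane) (a b : ℤ) (R : ℕ) (e o : ℂ[X]) : Prop where
  natDegree_fst : e.natDegree ≤ R
  coeff_fst : e.coeff R = (-1) ^ R
  natDegree_snd : o = 0 ∨ o.natDegree + 2 ≤ R
  regY_eq : ∀ v ∉ (periods τ).lattice,
    regY τ a b R v = e.eval (wp τ v) - dwp τ v * o.eval (wp τ v)
  pell : e ^ 2 - cubic τ * o ^ 2 = (X - C (zStar τ a b R)) ^ (2 * R)
  eval_ne : e.eval (zStar τ a b R) -
    dwp τ (torsionPt τ a b R) * o.eval (zStar τ a b R) ≠ 0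

lemma exists_isPellPair (hR : 0 < R) (hq2 : 2 * torsionPt τ a b R ∉ (periods τ).lattice) :
    ∃ e o : ℂ[X], IsPellPair τ a b R e o := by
  have hq : torsionPt τ a b R ∉ (periods τ).lattice := fun h =>
    hq2 (by rw [two_mul]; exact add_mem h h)
  have hA := isElliptic_regY hR hq
  obtain ⟨g, hg, hg0, hge⟩ := exists_analyticAt_regY hq
  have hgn := analyticAt_comp_neg_zero hg
  obtain ⟨e, he1, he2, he3⟩ := IsElliptic.exists_polynomial R
    (g := fun v => 2⁻¹ * (g v + g (-v))) ((hA.add hA.comp_neg).const_mul 2⁻¹)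
    (fun v _ => by rw [neg_neg, add_comm]) (analyticAt_const.mul (hg.add hgn)) (by
      filter_upwards [self_mem_nhdsWithin] with v hv
      rw [← hge v hv, ← hge (-v) (neg_ne_zero.2 hv), Even.neg_pow (even_two_mul R)]
      ring)
  -- The leading pole of order `2R` is even and cancels in the odd part.
  obtain ⟨o, ho1, ho3⟩ := IsElliptic.exists_polynomial_of_odd (m := R)
    (g := fun v => 2⁻¹ * (g (-v) - g v)) ((hA.comp_neg.sub hA).const_mul 2⁻¹)
    (fun v _ => by rw [neg_neg]; ring) (analyticAt_const.mul (hgn.sub hg)) (by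
      filter_upwards [self_mem_nhdsWithin] with v hv
      rw [← hge v hv, ← hge (-v) (neg_ne_zero.2 hv), Even.neg_pow (even_two_mul R)]
      ring) (by simp)
  have hY : ∀ v ∉ (periods τ).lattice,
      regY τ a b R v = e.eval (wp τ v) - dwp τ v * o.eval (wp τ v) := fun v hv => by
    rw [← he3 v hv, ← ho3 v hv]; ring
  refine ⟨e, o, he1, by rw [he2, neg_zero, hg0]; ring, ho1, hY, ?_, ?_⟩
  · refine polynomial_eq_of_eval_wp (τ := τ) fun v hv _ => ?_
    have h2 := hY (-v) (by simpa using hv)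
    rw [wp_neg, dwp_neg] at h2
    simp only [eval_sub, eval_mul, eval_pow, eval_X, eval_C]
    rw [eval_cubic hv, ← regY_mul_neg hq hv, hY v hv, h2]
    ring
  · rw [zStar, ← hY _ hq]
    exact regY_torsionPt_ne_zero hq2

end GenusOneTorsion

/-! ### Inverse square roots of a cubic and their Taylor coefficients. -/

namespace GenusOneTorsion

open Polynomial

/-- Truncated inverse square roots of a polynomial. -/
lemma exists_inv_sqrt {p : ℂ[X]} {c y : ℂ} (hy : y ≠ 0) (hp : p.eval c = y ^ 2) (n : ℕ) :
    ∃ σ : ℂ[X], σ.eval c = y⁻¹ ∧ (X - C c) ^ (n + 1) ∣ σ ^ 2 * p - 1 := by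
  induction n with
  | zero =>
    refine ⟨C y⁻¹, by simp, ?_⟩
    rw [zero_add, pow_one, dvd_iff_isRoot]
    simp [hp, hy]
  | succ n ih =>
    obtain ⟨σ, h1, k, hk⟩ := ih
    refine ⟨σ + C (-k.eval c / (2 * y)) * (X - C c) ^ (n + 1), by simp [h1], ?_⟩
    -- Hensel step: the next error coefficient at `c` is `k(c) + 2 d σ(c) p(c) = k(c) + 2 d y`, and
    -- `d` makes it vanish.
    set d : ℂ := -k.eval c / (2 * y) with hd
    have hroot : X - C c ∣ k + C (2 * d) * σ * p + C d ^ 2 * (X - C c) ^ (n + 1) * p := by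
      rw [dvd_iff_isRoot]
      simp only [IsRoot, eval_add, eval_mul, eval_C, eval_pow, eval_sub, eval_X, h1, hp, sub_self]
      rw [hd, zero_pow (by omega)]
      field_simp
      ring
    have := mul_dvd_mul_left ((X - C c) ^ (n + 1)) hroot
    rw [← pow_succ] at this
    convert this using 1
    rw [C_mul, show (C (2 : ℂ)) = 2 from rfl]
    linear_combination hk

lemma coeff_X_mul_derivative (σ : ℂ[X]) (n : ℕ) :
    (X * derivative σ).coeff n = n * σ.coeff n := by
  cases n with
  | zero => simp
  | succ n => rw [coeff_X_mul, coeff_derivative]; push_cast; ring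

/-- Three consecutive Taylor coefficients of `p^{-1/2}`, `p` a cubic, do not all vanish. -/
lemma coeff_inv_sqrt_cubic {p σ : ℂ[X]} {N : ℕ} (hN : 2 ≤ N) (hp : p.natDegree ≤ 3)
    (hp3 : p.coeff 3 ≠ 0) (hσ : X ^ N ∣ σ ^ 2 * p - 1) (h1 : σ.coeff (N - 1) = 0)
    (h2 : σ.coeff (N - 2) = 0) (h3 : 3 ≤ N → σ.coeff (N - 3) = 0) : False := by
  have hσ0 : σ.coeff 0 ≠ 0 := by
    intro h0
    have := X_pow_dvd_iff.1 hσ 0 (by omega)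
    rw [coeff_sub, mul_coeff_zero, pow_two, mul_coeff_zero, h0] at this
    simp at this
  -- Apply `X d/dX` to `σ²p = 1 + X^N k`, which keeps divisibility by `X ^ N`, and cancel `σ`, whose
  -- constant term is nonzero.
  have hD : X ^ N ∣ 2 * p * (X * derivative σ) + X * derivative p * σ := by
    refine prime_X.pow_dvd_of_dvd_mul_left N (a := σ) (by rwa [X_dvd_iff]) ?_
    obtain ⟨k, hk⟩ := hσ
    have hd := congrArg derivative hk
    simp only [derivative_mul, derivative_sub, derivative_pow, derivative_one, derivative_X] at hd
    have hXN : (X : ℂ[X]) * X ^ (N - 1) = X ^ N := by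
      rw [← pow_succ', Nat.sub_add_cancel (by omega)]
    refine ⟨C (N : ℂ) * k + X * derivative k, ?_⟩
    simp only [Nat.add_one_sub_one, pow_one, map_natCast, Nat.cast_ofNat] at hd ⊢
    rw [show (C (2 : ℂ)) = 2 from rfl] at hd
    linear_combination X * hd + N * k * hXN
  -- The coefficient of `X ^ (n + 3)` in `hD` reduces to `(2n + 3) p₃ σₙ`, and `2n + 3` is never
  -- zero.
  have hrec : ∀ n, n + 3 < N → σ.coeff (n + 3) = 0 → σ.coeff (n + 2) = 0 → σ.coeff (n + 1) = 0 →
      σ.coeff n = 0 := by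
    intro n hn e3 e2 e1
    have h := X_pow_dvd_iff.1 hD _ hn
    have hps : p = C (p.coeff 0) + C (p.coeff 1) * X ^ 1 + C (p.coeff 2) * X ^ 2 +
        C (p.coeff 3) * X ^ 3 := by
      conv_lhs => rw [p.as_sum_range_C_mul_X_pow' (n := 4) (by omega)]
      simp [Finset.sum_range_succ]
    have hXp : X * derivative p = C (p.coeff 1) * X ^ 1 + C (2 * p.coeff 2) * X ^ 2 +
        C (3 * p.coeff 3) * X ^ 3 := by
      ext m
      rw [coeff_X_mul_derivative]
      conv_lhs => rw [hps]
      simp only [coeff_add, coeff_C_mul, coeff_X_pow, coeff_C]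
      rcases m with _ | _ | _ | _ | m <;> simp
    rw [hXp] at h
    have hA : (2 * p * (X * derivative σ)).coeff (n + 3) = 2 * (p.coeff 3 * (n * σ.coeff n)) := by
      conv_lhs => rw [hps]
      simp only [mul_add, add_mul, mul_assoc, coeff_add, coeff_ofNat_mul, coeff_C_mul]
      have a3 := coeff_X_pow_mul (X * derivative σ) 3 n
      have a2 := coeff_X_pow_mul (X * derivative σ) 2 (n + 1)
      have a1 := coeff_X_pow_mul (X * derivative σ) 1 (n + 2)
      rw [coeff_X_mul_derivative] at a3 a2 a1
      rw [a3, show n + 3 = n + 1 + 2 from rfl, a2, show n + 1 + 2 = n + 2 + 1 from rfl, a1,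
        coeff_X_mul_derivative, e1, e2, show n + 2 + 1 = n + 3 from rfl, e3]
      ring
    have hB : ((C (p.coeff 1) * X ^ 1 + C (2 * p.coeff 2) * X ^ 2 +
        C (3 * p.coeff 3) * X ^ 3) * σ).coeff (n + 3) = 3 * p.coeff 3 * σ.coeff n := by
      simp only [add_mul, mul_assoc, coeff_add, coeff_C_mul]
      have a3 := coeff_X_pow_mul σ 3 n
      have a2 := coeff_X_pow_mul σ 2 (n + 1)
      have a1 := coeff_X_pow_mul σ 1 (n + 2)
      rw [a3, show n + 3 = n + 1 + 2 from rfl, a2, show n + 1 + 2 = n + 2 + 1 from rfl, a1, e1, e2]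
      ring
    rw [coeff_add, hA, hB] at h
    have h4 : p.coeff 3 * ((2 * n + 3 : ℕ) : ℂ) * σ.coeff n = 0 := by
      push_cast
      linear_combination h
    have h5 : ((2 * n + 3 : ℕ) : ℂ) ≠ 0 := by
      exact Nat.cast_ne_zero.2 (by omega)
    exact (mul_eq_zero.1 h4).resolve_left (mul_ne_zero hp3 h5)
  have hdown : ∀ j, j < N → σ.coeff (N - 1 - j) = 0 := by
    intro j
    induction j using Nat.strong_induction_on with
    | _ j ih =>
      intro hj
      rcases j with _ | _ | _ | j
      · exact h1
      · rw [show N - 1 - 1 = N - 2 by omega]; exact h2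
      · rw [show N - 1 - 2 = N - 3 by omega]; exact h3 (by omega)
      · have i1 := ih j (by omega) (by omega)
        have i2 := ih (j + 1) (by omega) (by omega)
        have i3 := ih (j + 2) (by omega) (by omega)
        refine hrec _ (by omega) ?_ ?_ ?_
        · rwa [show N - 1 - (j + 3) + 3 = N - 1 - j by omega]
        · rwa [show N - 1 - (j + 3) + 2 = N - 1 - (j + 1) by omega]
        · rwa [show N - 1 - (j + 3) + 1 = N - 1 - (j + 2) by omega]
  have := hdown (N - 1) (by omega)
  rw [Nat.sub_self] at this
  exact hσ0 this

lemma coeff_taylor_of_natDegree_le {f : ℂ[X]} {n : ℕ} (hf : f.natDegree ≤ n) (c : ℂ) :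
    (taylor c f).coeff n = f.coeff n := by
  rcases hf.lt_or_eq with h | rfl
  · rw [coeff_eq_zero_of_natDegree_lt h, coeff_eq_zero_of_natDegree_lt (by rwa [natDegree_taylor])]
  · rw [coeff_taylor_natDegree, coeff_natDegree]

/-- The remainder has degree at most `n`, so translation by `c` keeps its coefficient of index `n`,
while the discarded multiple of `(X - c) ^ (n + 1)` does not reach that index. -/
lemma coeff_modByMonic_X_sub_C_pow (f : ℂ[X]) (c : ℂ) (n : ℕ) :
    (f %ₘ (X - C c) ^ (n + 1)).coeff n = (taylor c f).coeff n := by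
  have hm : ((X - C c) ^ (n + 1)).Monic := (monic_X_sub_C c).pow _
  have hd : (f %ₘ (X - C c) ^ (n + 1)).natDegree ≤ n := by
    have := natDegree_modByMonic_lt f hm (by
      intro h; simpa using congrArg natDegree h)
    rw [natDegree_pow, natDegree_X_sub_C, mul_one] at this
    omega
  conv_rhs => rw [← modByMonic_add_div f ((X - C c) ^ (n + 1))]
  rw [map_add, coeff_add, coeff_taylor_of_natDegree_le hd, taylor_mul, taylor_pow]
  simp only [map_sub, taylor_X, taylor_C, add_sub_cancel_right]
  rw [X_pow_dvd_iff.1 (Dvd.intro _ rfl) n (Nat.lt_succ_self n), add_zero]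

end GenusOneTorsion

namespace GenusOneTorsion

open Complex Filter Topology Polynomial Metric

/-! ### The contour integral -/

section contour

variable {c z : ℂ} {ε : ℝ}

lemma sub_ne_zero_of_mem_sphere {w : ℂ} (hε : 0 < ε) (hz : ε < ‖z - c‖) (hw : w ∈ sphere c ε) :
    w - c ≠ 0 ∧ w - z ≠ 0 := by
  rw [mem_sphere_iff_norm] at hw
  constructor
  · rw [← norm_pos_iff, hw]; exact hε
  · rw [sub_ne_zero]
    rintro rfl
    exact hz.ne' hw

lemma integral_div_sub_eq_zero {r : ℝ} {h : ℂ → ℂ} (hh : DifferentiableOn ℂ h (ball c r))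
    (hε : 0 < ε) (hr : ε < r) (hz : ε < ‖z - c‖) : ∮ w in C(c, ε), h w / (w - z) = 0 := by
  have hne : ∀ w ∈ closedBall c ε, w - z ≠ 0 := by
    intro w hw h0
    rw [sub_eq_zero.1 h0, mem_closedBall_iff_norm] at hw
    linarith
  have hd : DifferentiableOn ℂ (fun w => h w / (w - z)) (closedBall c ε) :=
    (hh.mono (closedBall_subset_ball hr)).div (by fun_prop) hne
  refine circleIntegral_eq_zero_of_differentiable_on_off_countable hε.le Set.countable_empty
    hd.continuousOn fun w hw => ?_
  exact hd.differentiableAt (mem_of_superset (isOpen_ball.mem_nhds hw.1) ball_subset_closedBall)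

lemma circleIntegrable_div (hε : 0 < ε) (hz : ε < ‖z - c‖) {f : ℂ → ℂ}
    (hf : ContinuousOn f (sphere c ε)) (n : ℕ) :
    CircleIntegrable (fun w => f w / ((w - c) ^ n * (w - z))) c ε := by
  refine ContinuousOn.circleIntegrable hε.le (hf.div (by fun_prop) fun w hw => ?_)
  obtain ⟨h1, h2⟩ := sub_ne_zero_of_mem_sphere hε hz hw
  exact mul_ne_zero (pow_ne_zero n h1) h2

lemma integral_inv_pow_mul (hε : 0 < ε) (hz : ε < ‖z - c‖) (n : ℕ) :
    ∮ w in C(c, ε), 1 / ((w - c) ^ (n + 1) * (w - z)) =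
      -(2 * Real.pi * I) / (z - c) ^ (n + 1) := by
  have hs : z - c ≠ 0 := norm_pos_iff.1 (hε.trans hz)
  -- Partial fractions; among the pure powers of `w - c` only the exponent `-1` has a nonzero
  -- integral.
  have key : ∀ n : ℕ, ∮ w in C(c, ε), 1 / ((w - c) ^ (n + 1) * (w - z)) =
      (z - c)⁻¹ * ((∮ w in C(c, ε), 1 / ((w - c) ^ n * (w - z))) -
        ∮ w in C(c, ε), (w - c) ^ (-(n + 1 : ℕ) : ℤ)) := by
    intro n
    rw [← circleIntegral.integral_sub (circleIntegrable_div hε hz continuousOn_const n),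
      ← circleIntegral.integral_const_mul]
    · refine circleIntegral.integral_congr hε.le fun w hw => ?_
      obtain ⟨h1, h2⟩ := sub_ne_zero_of_mem_sphere hε hz hw
      simp only [zpow_neg, zpow_natCast]
      field_simp
      ring
    · refine ContinuousOn.circleIntegrable hε.le ?_
      simp only [zpow_neg, zpow_natCast]
      exact ContinuousOn.inv₀ (by fun_prop) fun w hw =>
        pow_ne_zero _ (sub_ne_zero_of_mem_sphere hε hz hw).1
  induction n with
  | zero =>
    have h0 := integral_div_sub_eq_zero (h := fun _ => 1) (r := ε + 1) (c := c)
      (by fun_prop) hε (by linarith) hz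
    have h1 := circleIntegral.integral_sub_center_inv c hε.ne'
    rw [key 0]
    simp only [pow_zero, one_mul, h0, zero_add, Nat.cast_one, zpow_neg, zpow_one, h1, pow_one]
    field_simp
    ring
  | succ n ih =>
    rw [key (n + 1), ih, circleIntegral.integral_sub_zpow_of_ne (by push_cast; omega)]
    field_simp
    ring

lemma integral_polynomial_div (hε : 0 < ε) (hz : ε < ‖z - c‖) (N : ℕ) (T : ℂ[X])
    (hT : T.degree < N) :
    ∮ w in C(c, ε), T.eval w / ((w - c) ^ N * (w - z)) =
      -(2 * Real.pi * I) * T.eval z / (z - c) ^ N := by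
  have hs : z - c ≠ 0 := norm_pos_iff.1 (hε.trans hz)
  induction N generalizing T with
  | zero =>
    have : T = 0 := by
      rw [← degree_eq_bot]
      exact Nat.WithBot.lt_zero_iff.1 hT
    simp [this, circleIntegral]
  | succ n ih =>
    obtain ⟨U, hU⟩ : X - C c ∣ T - C (T.eval c) := by
      rw [dvd_iff_isRoot]; simp
    have hTU : T = C (T.eval c) + (X - C c) * U := by linear_combination hU
    have hUd : U.degree < n := by
      by_cases hU0 : U = 0
      · simp [hU0]
      · have h1 : (X - C c) * U ≠ 0 := mul_ne_zero (X_sub_C_ne_zero c) hU0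
        have h2 : ((X - C c) * U).degree < ((n + 1 : ℕ) : WithBot ℕ) := by
          rw [← hU]
          exact (degree_sub_le _ _).trans_lt (max_lt hT
            (degree_C_le.trans_lt (by exact_mod_cast n.succ_pos)))
        rw [degree_eq_natDegree h1, natDegree_mul (X_sub_C_ne_zero c) hU0, natDegree_X_sub_C] at h2
        rw [degree_eq_natDegree hU0]
        have h3 : 1 + U.natDegree < n + 1 := by exact_mod_cast h2
        exact_mod_cast (by omega : U.natDegree < n)
    have h1 : ∮ w in C(c, ε), T.eval w / ((w - c) ^ (n + 1) * (w - z)) =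
        (T.eval c * ∮ w in C(c, ε), 1 / ((w - c) ^ (n + 1) * (w - z))) +
          ∮ w in C(c, ε), U.eval w / ((w - c) ^ n * (w - z)) := by
      rw [← circleIntegral.integral_const_mul, ← circleIntegral.integral_add]
      · refine circleIntegral.integral_congr hε.le fun w hw => ?_
        obtain ⟨h1, h2⟩ := sub_ne_zero_of_mem_sphere hε hz hw
        conv_lhs => rw [hTU]
        simp only [eval_add, eval_mul, eval_C, eval_sub, eval_X]
        field_simp
        ring
      · simpa only [mul_one_div] using
          circleIntegrable_div hε hz (f := fun _ => T.eval c) continuousOn_const (n + 1)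
      · exact circleIntegrable_div hε hz U.continuous.continuousOn _
    rw [h1, integral_inv_pow_mul hε hz, ih U hUd]
    conv_rhs => rw [hTU]
    simp only [eval_add, eval_mul, eval_C, eval_sub, eval_X]
    field_simp
    ring

lemma integral_div_of_eq_add {r : ℝ} {g h : ℂ → ℂ} {N : ℕ} {T : ℂ[X]} (hT : T.degree < N)
    (hh : DifferentiableOn ℂ h (ball c r)) (hε : 0 < ε) (hr : ε < r) (hz : ε < ‖z - c‖)
    (hg : ∀ w ∈ ball c r, g w = T.eval w + (w - c) ^ N * h w) :
    (2 * Real.pi * I)⁻¹ * ∮ w in C(c, ε), g w / ((w - c) ^ N * (w - z)) =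
      -(T.eval z / (z - c) ^ N) := by
  have h1 : ∮ w in C(c, ε), g w / ((w - c) ^ N * (w - z)) =
      (∮ w in C(c, ε), T.eval w / ((w - c) ^ N * (w - z))) + ∮ w in C(c, ε), h w / (w - z) := by
    rw [← circleIntegral.integral_add]
    · refine circleIntegral.integral_congr hε.le fun w hw => ?_
      obtain ⟨h1, h2⟩ := sub_ne_zero_of_mem_sphere hε hz hw
      rw [hg w (closedBall_subset_ball hr (sphere_subset_closedBall hw))]
      field_simp
    · exact circleIntegrable_div hε hz T.continuous.continuousOn _
    · refine ContinuousOn.circleIntegrable hε.le (ContinuousOn.div ?_ (by fun_prop) fun w hw => ?_)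
      · exact hh.continuousOn.mono (sphere_subset_closedBall.trans (closedBall_subset_ball hr))
      · exact (sub_ne_zero_of_mem_sphere hε hz hw).2
  have h2 := Complex.two_pi_I_ne_zero
  rw [h1, integral_polynomial_div hε hz N T hT, integral_div_sub_eq_zero hh hε hr hz]
  field_simp
  ring

/-- Division with remainder of an inverse square root by a power of `w - c`. -/
lemma exists_remainder {r : ℝ} {s : ℂ → ℂ} {σ p : ℂ[X]} {N : ℕ} (hr : 0 < r)
    (hs : DifferentiableOn ℂ s (ball c r)) (hsp : ∀ w ∈ ball c r, s w ^ 2 * p.eval w = 1)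
    (hsc : s c = σ.eval c) (hσ : (X - C c) ^ N ∣ σ ^ 2 * p - 1) :
    ∃ h : ℂ → ℂ, DifferentiableOn ℂ h (ball c r) ∧
      ∀ w ∈ ball c r, s w = σ.eval w + (w - c) ^ N * h w := by
  classical
  obtain ⟨k, hk⟩ := hσ
  have hk' : ∀ w, σ.eval w ^ 2 * p.eval w - 1 = (w - c) ^ N * k.eval w := fun w => by
    simpa using congrArg (eval w) hk
  have hc : c ∈ ball c r := mem_ball_self hr
  set D : ℂ → ℂ := fun w => (s w + σ.eval w) * p.eval w with hD
  have hDd : DifferentiableOn ℂ D (ball c r) := (hs.add (by fun_prop)).mul (by fun_prop)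
  have hDc : D c ≠ 0 := by
    intro h0
    have h1 := hsp c hc
    have : s c * D c = 2 := by
      simp only [hD]
      rw [← hsc]
      linear_combination 2 * h1
    rw [h0] at this
    norm_num at this
  have hDne : ∀ᶠ w in 𝓝 c, D w ≠ 0 :=
    (hDd.differentiableAt (isOpen_ball.mem_nhds hc)).continuousAt.eventually_ne hDc
  have hfac : ∀ w ∈ ball c r, (s w - σ.eval w) * D w = -((w - c) ^ N * k.eval w) := by
    intro w hw
    simp only [hD]
    rw [← hk']
    linear_combination hsp w hw
  -- By `hfac` the quotient equals `-k/D` near `c`, where `D` does not vanish; this removes the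
  -- singularity. Away from `c` the quotient needs no information on `D`.
  set h : ℂ → ℂ := fun w => if w = c then -k.eval c / D c else (s w - σ.eval w) / (w - c) ^ N
  have hne : ∀ w, w ≠ c → h w = (s w - σ.eval w) / (w - c) ^ N := fun w hw => if_neg hw
  have hloc : h =ᶠ[𝓝 c] fun w => -k.eval w / D w := by
    filter_upwards [hDne, isOpen_ball.mem_nhds hc] with w hw hwb
    by_cases hwc : w = c
    · simp [h, hwc]
    · rw [hne w hwc, div_eq_div_iff (pow_ne_zero N (sub_ne_zero.2 hwc)) hw, hfac w hwb]
      ring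
  refine ⟨h, fun w hw => DifferentiableAt.differentiableWithinAt ?_, fun w hw => ?_⟩
  · by_cases hwc : w = c
    · subst hwc
      refine DifferentiableAt.congr_of_eventuallyEq ?_ hloc
      exact DifferentiableAt.div (by fun_prop)
        (hDd.differentiableAt (isOpen_ball.mem_nhds hc)) hDc
    · have h1 : h =ᶠ[𝓝 w] fun w => (s w - σ.eval w) / (w - c) ^ N := by
        filter_upwards [isOpen_compl_singleton.mem_nhds hwc] with u hu
        exact hne u hu
      refine DifferentiableAt.congr_of_eventuallyEq ?_ h1
      exact DifferentiableAt.div ((hs.differentiableAt (isOpen_ball.mem_nhds hw)).sub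
        (by fun_prop)) (by fun_prop) (pow_ne_zero N (sub_ne_zero.2 hwc))
  · by_cases hwc : w = c
    · have h1 := hfac w hw
      subst hwc
      have h2 : h w = -k.eval w / D w := hloc.eq_of_nhds
      rw [h2]
      have h3 := eq_div_of_mul_eq hDc h1
      rw [eq_add_of_sub_eq h3]
      ring
    · have := pow_ne_zero N (sub_ne_zero.2 hwc)
      rw [hne w hwc]
      field_simp
      ring

end contour

/-! ### The first sheet -/

section sheet

variable {τ : UpperHalfPlane} {a b : ℤ} {R : ℕ} {r : ℝ} {V : ℂ → ℂ}

lemma exists_isFirstSheet (hq2 : 2 * torsionPt τ a b R ∉ (periods τ).lattice) :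
    ∃ r > 0, ∃ V : ℂ → ℂ, IsFirstSheet τ a b R r V := by
  have hq : torsionPt τ a b R ∉ (periods τ).lattice := fun h =>
    hq2 (by rw [two_mul]; exact add_mem h h)
  have hd : dwp τ (torsionPt τ a b R) ≠ 0 := (dwp_eq_zero_iff hq).not.2 hq2
  have hc : ContDiffAt ℂ 1 (wp τ) (torsionPt τ a b R) := (analyticAt_wp hq).contDiffAt
  have hf : HasFDerivAt (wp τ) ((ContinuousLinearEquiv.unitsEquivAut ℂ
      (Units.mk0 _ hd) : ℂ ≃L[ℂ] ℂ) : ℂ →L[ℂ] ℂ) (torsionPt τ a b R) := by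
    refine (hasDerivAt_wp hq).hasFDerivAt.congr_fderiv ?_
    ext
    simp
  set V := hc.localInverse hf one_ne_zero with hV
  have h1 : ∀ᶠ w in 𝓝 (zStar τ a b R), ContDiffAt ℂ 1 V w :=
    (hc.to_localInverse hf one_ne_zero).eventually (by simp)
  have h2 : ∀ᶠ w in 𝓝 (zStar τ a b R), wp τ (V w) = w :=
    HasStrictFDerivAt.eventually_right_inverse _
  obtain ⟨r, hr, hb⟩ := Metric.eventually_nhds_iff_ball.1 (h1.and h2)
  exact ⟨r, hr, V, fun w hw => ((hb w hw).1.differentiableAt one_ne_zero).differentiableWithinAt,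
    fun w hw => (hb w hw).2, hc.localInverse_apply_image hf one_ne_zero⟩

/-- As a total function `℘` has a finite value even at lattice points, so `wp_eq` at `w` alone does
not exclude them. If `V w` were one, `(V u - V w)² u` would tend to `1` as `u → w` by the double
pole of `℘`, and to `0` by continuity of `V`. -/
lemma IsFirstSheet.notMem (hV : IsFirstSheet τ a b R r V) {w : ℂ}
    (hw : w ∈ ball (zStar τ a b R) r) : V w ∉ (periods τ).lattice := by
  intro hl
  obtain ⟨g, hg, hg0, hge⟩ := exists_analyticAt_sq_mul_wp τ
  have hVc : ContinuousAt V w :=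
    (hV.differentiableOn.differentiableAt (isOpen_ball.mem_nhds hw)).continuousAt
  have hg' : ContinuousAt g (V w - V w) := by simpa using hg.continuousAt
  have h1 : ContinuousAt (fun u => g (V u - V w)) w :=
    ContinuousAt.comp (f := fun u => V u - V w) hg' (hVc.sub continuousAt_const)
  have h2 : ContinuousAt (fun u => (V u - V w) ^ 2 * u) w := by fun_prop
  have e : (fun u => g (V u - V w)) =ᶠ[𝓝[≠] w] fun u => (V u - V w) ^ 2 * u := by
    filter_upwards [nhdsWithin_le_nhds (isOpen_ball.mem_nhds hw), self_mem_nhdsWithin] with u hu hne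
    have hne' : V u - V w ≠ 0 := by
      rw [sub_ne_zero]
      intro h
      apply hne
      rw [Set.mem_singleton_iff, ← hV.wp_eq u hu, h, hV.wp_eq w hw]
    rw [hge _ hne', sub_eq_add_neg (V u), wp_add_mem (neg_mem hl), hV.wp_eq u hu]
  have h3 := tendsto_nhds_unique ((h1.tendsto.mono_left nhdsWithin_le_nhds).congr' e)
    (h2.tendsto.mono_left nhdsWithin_le_nhds)
  simp [hg0] at h3

lemma IsFirstSheet.dwp_ne_zero (hV : IsFirstSheet τ a b R r V) {w : ℂ}
    (hw : w ∈ ball (zStar τ a b R) r) : dwp τ (V w) ≠ 0 := by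
  have h1 := (hasDerivAt_wp (hV.notMem hw)).comp w
    (hV.differentiableOn.differentiableAt (isOpen_ball.mem_nhds hw)).hasDerivAt
  have h2 : HasDerivAt (wp τ ∘ V) 1 w := by
    refine (hasDerivAt_id w).congr_of_eventuallyEq ?_
    filter_upwards [isOpen_ball.mem_nhds hw] with u hu
    exact hV.wp_eq u hu
  intro h0
  rw [h0, zero_mul] at h1
  exact zero_ne_one (h1.unique h2)

lemma IsFirstSheet.differentiableOn_inv_dwp (hV : IsFirstSheet τ a b R r V) :
    DifferentiableOn ℂ (fun w => (dwp τ (V w))⁻¹) (ball (zStar τ a b R) r) := by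
  intro w hw
  have h1 := hV.differentiableOn.differentiableAt (isOpen_ball.mem_nhds hw)
  have h2 := (analyticAt_dwp (hV.notMem hw)).differentiableAt
  exact ((h2.comp w h1).inv (hV.dwp_ne_zero hw)).differentiableWithinAt

end sheet

end GenusOneTorsion

/-! ### The matrix polynomial, its degree and its top coefficient. -/

namespace GenusOneTorsion

open Complex Filter Topology Polynomial Metric

/-- The matrix `M` of the pair `(m₁, m₂)`, with upper right entry `2 (x₀ - z)`. -/
noncomputable def specMat (x₀ : ℂ) (m₁ m₂ : ℂ[X]) : Matrix (Fin 2) (Fin 2) ℂ[X] :=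
  !![m₁, C 2 * (C x₀ - X); m₂, -m₁]

/-- The polynomial matrix `(1 + σ M) / 2`. -/
noncomputable def halfMat (σ : ℂ[X]) (M : Matrix (Fin 2) (Fin 2) ℂ[X]) :
    Matrix (Fin 2) (Fin 2) ℂ[X] :=
  (C (1 / 2) : ℂ[X]) • (1 + σ • M)

/-- The Taylor polynomial of `(1 + σ M) / 2` at `c`, of degree less than `N`. -/
noncomputable def truncMat (c : ℂ) (N : ℕ) (σ : ℂ[X]) (M : Matrix (Fin 2) (Fin 2) ℂ[X]) :
    Matrix (Fin 2) (Fin 2) ℂ[X] :=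
  (halfMat σ M).map (· %ₘ (X - C c) ^ N)

/-- The polynomial matrix `-(z - c)^{-N} T (e + o M)`. -/
noncomputable def quotMat (c : ℂ) (N : ℕ) (σ e o : ℂ[X]) (M : Matrix (Fin 2) (Fin 2) ℂ[X]) :
    Matrix (Fin 2) (Fin 2) ℂ[X] :=
  (truncMat c N σ M * (e • 1 + o • M)).map fun f => -(f /ₘ (X - C c) ^ N)

section algebra

variable {c : ℂ} {N : ℕ} {σ e o p : ℂ[X]} {M : Matrix (Fin 2) (Fin 2) ℂ[X]}

lemma halfMat_eq (i j : Fin 2) : halfMat σ M i j = truncMat c N σ M i j +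
    (X - C c) ^ N * (halfMat σ M i j /ₘ (X - C c) ^ N) :=
  (modByMonic_add_div _ _).symm

lemma eval_halfMat (w : ℂ) (i j : Fin 2) : (halfMat σ M i j).eval w =
    1 / 2 * ((1 : Matrix (Fin 2) (Fin 2) ℂ) i j + σ.eval w * (M i j).eval w) := by
  rw [halfMat, Matrix.smul_apply, smul_eq_mul, eval_mul, eval_C, Matrix.add_apply, eval_add,
    Matrix.smul_apply, smul_eq_mul, eval_mul, Matrix.one_apply, Matrix.one_apply]
  split_ifs <;> simp

lemma degree_truncMat (i j : Fin 2) : (truncMat c N σ M i j).degree < N := by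
  have := degree_modByMonic_lt (halfMat σ M i j) ((monic_X_sub_C c).pow N)
  rwa [degree_pow, degree_X_sub_C, nsmul_one] at this

/-- Modulo `(X - c) ^ N`, twice the product is `(e + σpo) + (o + σe)M`. The factor `e - σpo` is
prime to `X - c` by `hne`, so the Pell equation kills `e + σpo`, and `o + σe` is `σ` times it. -/
lemma dvd_truncMat_mul (hM : M * M = p • 1) (hσ : (X - C c) ^ N ∣ σ ^ 2 * p - 1)
    (hpell : (X - C c) ^ N ∣ e ^ 2 - p * o ^ 2) (hne : e.eval c ≠ σ.eval c * p.eval c * o.eval c)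
    (i j : Fin 2) : (X - C c) ^ N ∣ (truncMat c N σ M * (e • 1 + o • M)) i j := by
  have h1 : (X - C c) ^ N ∣ e + σ * p * o := by
    refine (prime_X_sub_C c).pow_dvd_of_dvd_mul_left N (a := e - σ * p * o) ?_ ?_
    · rw [dvd_iff_isRoot, IsRoot, eval_sub, eval_mul, eval_mul, sub_eq_zero]
      exact hne
    · have := hpell.sub (hσ.mul_left (p * o ^ 2))
      convert this using 1
      ring
  have h2 : (X - C c) ^ N ∣ o + σ * e := by
    have := (h1.mul_left σ).sub (hσ.mul_left o)
    convert this using 1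
    ring
  obtain ⟨k1, hk1⟩ := h1
  obtain ⟨k2, hk2⟩ := h2
  set d := (X - C c) ^ N with hd
  set Q : Matrix (Fin 2) (Fin 2) ℂ[X] := (halfMat σ M).map (· /ₘ d) with hQ
  have hT : truncMat c N σ M = halfMat σ M - d • Q := by
    ext1 i j
    rw [Matrix.sub_apply, halfMat_eq (c := c) (N := N) i j]
    simp [hQ, hd]
  have key : truncMat c N σ M * (e • 1 + o • M) =
      d • ((C (1 / 2) : ℂ[X]) • (k1 • (1 : Matrix (Fin 2) (Fin 2) ℂ[X]) + k2 • M) -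
        Q * (e • 1 + o • M)) := by
    rw [hT, sub_mul, smul_sub, smul_mul_assoc, halfMat]
    congr 1
    simp only [add_mul, mul_add, smul_mul_assoc, mul_smul_comm, one_mul, mul_one, hM, smul_add,
      smul_smul]
    rw [mul_left_comm d, ← hk1, mul_left_comm d, ← hk2]
    module
  rw [key]
  exact Dvd.intro _ rfl

lemma truncMat_mul_eq (hM : M * M = p • 1) (hσ : (X - C c) ^ N ∣ σ ^ 2 * p - 1)
    (hpell : (X - C c) ^ N ∣ e ^ 2 - p * o ^ 2) (hne : e.eval c ≠ σ.eval c * p.eval c * o.eval c)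
    (i j : Fin 2) : (truncMat c N σ M * (e • 1 + o • M)) i j =
      (X - C c) ^ N * -quotMat c N σ e o M i j := by
  have h := dvd_truncMat_mul hM hσ hpell hne i j
  have h1 := (modByMonic_eq_zero_iff_dvd ((monic_X_sub_C c).pow N)).2 h
  have h2 := modByMonic_add_div ((truncMat c N σ M * (e • 1 + o • M)) i j) ((X - C c) ^ N)
  rw [h1, zero_add] at h2
  simp [quotMat, h2]

lemma specMat_mul_self {x₀ : ℂ} {m₁ m₂ : ℂ[X]} (h : m₁ ^ 2 + (C 2 * (C x₀ - X)) * m₂ = p) :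
    specMat x₀ m₁ m₂ * specMat x₀ m₁ m₂ = p • 1 := by
  rw [← h, specMat]
  ext1 i j
  fin_cases i <;> fin_cases j <;> simp [Matrix.mul_apply, Fin.sum_univ_two] <;> ring

variable {R : ℕ} {x₀ : ℂ} {m₁ m₂ : ℂ[X]}

lemma natDegree_specMat (h1 : m₁.natDegree ≤ 1) (h2 : m₂.natDegree ≤ 2) (i j : Fin 2) :
    (specMat x₀ m₁ m₂ i j).natDegree ≤ 2 := by
  fin_cases i <;> fin_cases j
  · simpa [specMat] using h1.trans one_le_two
  · have : (C (2 : ℂ) * (C x₀ - X)).natDegree ≤ 1 := by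
      compute_degree
    simpa [specMat] using this.trans one_le_two
  · simpa [specMat] using h2
  · simpa [specMat] using h1.trans one_le_two

lemma natDegree_right (he : e.natDegree ≤ R) (ho : o = 0 ∨ o.natDegree + 2 ≤ R)
    (h1 : m₁.natDegree ≤ 1) (h2 : m₂.natDegree ≤ 2) (i j : Fin 2) :
    ((e • 1 + o • specMat x₀ m₁ m₂ : Matrix (Fin 2) (Fin 2) ℂ[X]) i j).natDegree ≤ R := by
  rw [Matrix.add_apply, Matrix.smul_apply, Matrix.smul_apply, smul_eq_mul, smul_eq_mul]
  refine natDegree_add_le_of_degree_le ?_ ?_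
  · rw [Matrix.one_apply]
    split_ifs
    · simpa using he
    · simp
  · rcases ho with rfl | ho
    · simp
    · exact natDegree_mul_le.trans ((Nat.add_le_add_left (natDegree_specMat h1 h2 i j) _).trans ho)

lemma natDegree_truncMat (hR : 0 < R) (i j : Fin 2) :
    (truncMat c (2 * R) σ M i j).natDegree ≤ 2 * R - 1 := by
  by_cases h : truncMat c (2 * R) σ M i j = 0
  · simp [h]
  · have h1 := degree_truncMat (c := c) (N := 2 * R) (σ := σ) (M := M) i j
    rw [degree_eq_natDegree h] at h1
    have h2 : (truncMat c (2 * R) σ M i j).natDegree < 2 * R := by exact_mod_cast h1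
    omega

lemma natDegree_quotMat (hR : 0 < R) (he : e.natDegree ≤ R) (ho : o = 0 ∨ o.natDegree + 2 ≤ R)
    (h1 : m₁.natDegree ≤ 1) (h2 : m₂.natDegree ≤ 2) (i j : Fin 2) :
    (quotMat c (2 * R) σ e o (specMat x₀ m₁ m₂) i j).natDegree ≤ R - 1 := by
  rw [quotMat, Matrix.map_apply, natDegree_neg, natDegree_divByMonic _ ((monic_X_sub_C c).pow _),
    natDegree_pow, natDegree_X_sub_C, mul_one]
  have : ((truncMat c (2 * R) σ (specMat x₀ m₁ m₂) *
      (e • 1 + o • specMat x₀ m₁ m₂)) i j).natDegree ≤ (2 * R - 1) + R := by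
    rw [Matrix.mul_apply]
    refine natDegree_sum_le_of_forall_le _ _ fun k _ => ?_
    exact natDegree_mul_le.trans (add_le_add (natDegree_truncMat hR i k)
      (natDegree_right he ho h1 h2 k j))
  omega

/-- The top coefficient of the Taylor polynomial vanishes if that of the quotient does. -/
lemma coeff_truncMat_eq_zero (hR : 0 < R) (he : e.natDegree ≤ R) (heR : e.coeff R = (-1) ^ R)
    (ho : o = 0 ∨ o.natDegree + 2 ≤ R) (h1 : m₁.natDegree ≤ 1) (h2 : m₂.natDegree ≤ 2)
    (hmul : ∀ i j, (truncMat c (2 * R) σ (specMat x₀ m₁ m₂) *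
      (e • 1 + o • specMat x₀ m₁ m₂)) i j =
        (X - C c) ^ (2 * R) * -quotMat c (2 * R) σ e o (specMat x₀ m₁ m₂) i j)
    (hq : ∀ i j, (quotMat c (2 * R) σ e o (specMat x₀ m₁ m₂) i j).coeff (R - 1) = 0)
    (i j : Fin 2) : (truncMat c (2 * R) σ (specMat x₀ m₁ m₂) i j).coeff (2 * R - 1) = 0 := by
  set W : Matrix (Fin 2) (Fin 2) ℂ[X] := e • 1 + o • specMat x₀ m₁ m₂ with hW
  have hsum : ∀ i j, ∑ k, (truncMat c (2 * R) σ (specMat x₀ m₁ m₂) i k).coeff (2 * R - 1) *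
      (W k j).coeff R = 0 := by
    intro i j
    have h3 : ((truncMat c (2 * R) σ (specMat x₀ m₁ m₂) * W) i j).coeff (2 * R - 1 + R) =
        ((X - C c) ^ (2 * R) * -quotMat c (2 * R) σ e o (specMat x₀ m₁ m₂) i j).coeff
          (2 * R - 1 + R) := by rw [hmul i j]
    rw [show 2 * R - 1 + R = 2 * R + (R - 1) by omega,
      coeff_mul_add_eq_of_natDegree_le (by rw [natDegree_pow, natDegree_X_sub_C, mul_one])
        (by rw [natDegree_neg]; exact natDegree_quotMat hR he ho h1 h2 i j), coeff_neg, hq,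
      neg_zero, mul_zero, show 2 * R + (R - 1) = 2 * R - 1 + R by omega, Matrix.mul_apply,
      finsetSum_coeff] at h3
    rw [← h3]
    refine Finset.sum_congr rfl fun k _ => ?_
    rw [coeff_mul_add_eq_of_natDegree_le (natDegree_truncMat hR i k)
      (natDegree_right he ho h1 h2 k j)]
  have hlow : ∀ f : ℂ[X], f.natDegree ≤ 1 → (o * f).coeff R = 0 := by
    intro f hf
    rcases ho with rfl | ho
    · simp
    · exact coeff_eq_zero_of_natDegree_lt (natDegree_mul_le.trans_lt (by omega))
  have h00 : (W 0 0).coeff R = (-1) ^ R := by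
    simp [hW, specMat, hlow m₁ h1, heR]
  have h11 : (W 1 1).coeff R = (-1) ^ R := by
    simp [hW, specMat, hlow m₁ h1, heR]
  -- Only the lower left entry `o m₂` can reach degree `R` off the diagonal. The coefficient matrix
  -- is thus triangular, and the second column is settled before the first.
  have h01 : (W 0 1).coeff R = 0 := by
    have := hlow (C 2 * (C x₀ - X)) (by compute_degree)
    simpa [hW, specMat] using this
  have hone : ((-1 : ℂ) ^ R) ≠ 0 := pow_ne_zero R (by norm_num)
  have e1 : ∀ i, (truncMat c (2 * R) σ (specMat x₀ m₁ m₂) i 1).coeff (2 * R - 1) = 0 := by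
    intro i
    have := hsum i 1
    rw [Fin.sum_univ_two, h01, h11, mul_zero, zero_add] at this
    exact (mul_eq_zero.1 this).resolve_right hone
  have e0 : (truncMat c (2 * R) σ (specMat x₀ m₁ m₂) i 0).coeff (2 * R - 1) = 0 := by
    have := hsum i 0
    rw [Fin.sum_univ_two, h00, e1, zero_mul, add_zero] at this
    exact (mul_eq_zero.1 this).resolve_right hone
  fin_cases j
  · exact e0
  · exact e1 i

/-- Otherwise the Taylor coefficient of index `2R - 1` of every entry of `σM` vanishes. The linear
entries `2(x₀ - z)` and `m₁`, without common root by `hy`, kill two consecutive coefficients of `σ`;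
the quadratic `m₂` kills a third when it exists. -/
lemma exists_coeff_truncMat_ne_zero (hR : 0 < R) (hp : p.natDegree ≤ 3) (hp3 : p.coeff 3 ≠ 0)
    (hσ : (X - C c) ^ (2 * R) ∣ σ ^ 2 * p - 1) (h1 : m₁.natDegree ≤ 1) (h2 : m₂.natDegree ≤ 2)
    (h22 : m₂.coeff 2 ≠ 0) (hy : m₁.eval x₀ ≠ 0) :
    ∃ i j, (truncMat c (2 * R) σ (specMat x₀ m₁ m₂) i j).coeff (2 * R - 1) ≠ 0 := by
  by_contra! hT
  obtain ⟨n, hn⟩ : ∃ n, 2 * R = n + 1 := ⟨2 * R - 1, by omega⟩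
  have hn1 : 1 ≤ n := by omega
  rw [hn] at hT hσ
  rw [Nat.add_sub_cancel] at hT
  set s := taylor c σ with hs
  have hcoef : ∀ i j, (taylor c (σ * specMat x₀ m₁ m₂ i j)).coeff n = 0 := by
    intro i j
    have := hT i j
    rw [truncMat, Matrix.map_apply, coeff_modByMonic_X_sub_C_pow, halfMat, Matrix.smul_apply,
      smul_eq_mul, taylor_mul, taylor_C, coeff_C_mul, Matrix.add_apply, map_add, coeff_add,
      Matrix.smul_apply, smul_eq_mul, Matrix.one_apply] at this
    have h0 : (taylor c (if i = j then (1 : ℂ[X]) else 0)).coeff n = 0 := by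
      split_ifs
      · rw [taylor_one, coeff_C_of_ne_zero (by omega)]
      · simp
    rw [h0, zero_add] at this
    exact (mul_eq_zero.1 this).resolve_left (by norm_num)
  have hX : X ^ (n + 1) ∣ s ^ 2 * taylor c p - 1 := by
    have := map_dvd (taylorAlgHom c) hσ
    simpa [taylor_mul, taylor_pow] using this
  obtain ⟨m, rfl⟩ : ∃ m, n = m + 1 := ⟨n - 1, by omega⟩
  have c01 : (x₀ - c) * s.coeff (m + 1) - s.coeff m = 0 := by
    have := hcoef 0 1
    simp only [specMat, Matrix.cons_val', Matrix.cons_val_one, Matrix.cons_val_zero,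
      Matrix.of_apply, taylor_mul, taylor_C, map_sub, taylor_X, Matrix.cons_val_fin_one] at this
    rw [show s * (C 2 * (C x₀ - (X + C c))) = C 2 * (C (x₀ - c) * s - s * X) by
      rw [C_sub]; ring, coeff_C_mul, coeff_sub, coeff_C_mul, coeff_mul_X] at this
    exact (mul_eq_zero.1 this).resolve_left (by norm_num)
  have hs1 : s.coeff (m + 1) = 0 := by
    have := hcoef 0 0
    obtain ⟨u, w, rfl⟩ := exists_eq_X_add_C_of_natDegree_le_one h1
    simp only [specMat, Matrix.cons_val', Matrix.cons_val_zero, Matrix.of_apply, taylor_mul,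
      taylor_C, map_add, taylor_X, Matrix.cons_val_fin_one] at this
    rw [show s * (C u * (X + C c) + C w) = C (u * c + w) * s + C u * (s * X) by
      rw [C_add, C_mul]; ring, coeff_add, coeff_C_mul, coeff_C_mul, coeff_mul_X] at this
    simp only [eval_add, eval_mul, eval_C, eval_X] at hy
    have h3 : (u * x₀ + w) * s.coeff (m + 1) = 0 := by linear_combination this + u * c01
    exact (mul_eq_zero.1 h3).resolve_left hy
  have hs0 : s.coeff m = 0 := by linear_combination (x₀ - c) * hs1 - c01
  refine coeff_inv_sqrt_cubic (N := m + 1 + 1) (by omega) (by rwa [natDegree_taylor])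
    (by rwa [coeff_taylor_of_natDegree_le hp]) hX hs1 hs0 fun h3 => ?_
  obtain ⟨k, rfl⟩ : ∃ k, m = k + 1 := ⟨m - 1, by omega⟩
  have := hcoef 1 0
  simp only [specMat, Matrix.cons_val', Matrix.cons_val_zero, Matrix.cons_val_one, Matrix.of_apply,
    taylor_mul, Matrix.cons_val_fin_one] at this
  have hm : taylor c m₂ = C ((taylor c m₂).coeff 0) + C ((taylor c m₂).coeff 1) * X +
      C ((taylor c m₂).coeff 2) * X ^ 2 := by
    conv_lhs => rw [(taylor c m₂).as_sum_range_C_mul_X_pow' (n := 3)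
      (by rw [natDegree_taylor]; omega)]
    simp [Finset.sum_range_succ]
  rw [hm, coeff_taylor_of_natDegree_le h2, show s * (C ((taylor c m₂).coeff 0) +
    C ((taylor c m₂).coeff 1) * X + C (m₂.coeff 2) * X ^ 2) = C ((taylor c m₂).coeff 0) * s +
      C ((taylor c m₂).coeff 1) * (s * X) + C (m₂.coeff 2) * (s * X * X) by ring, coeff_add,
    coeff_add, coeff_C_mul, coeff_C_mul, coeff_C_mul, coeff_mul_X, coeff_mul_X, coeff_mul_X, hs1,
    hs0] at this
  simp only [mul_zero, zero_add] at this
  exact (mul_eq_zero.1 this).resolve_left h22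

end algebra

section formula

variable {τ : UpperHalfPlane} {α β : ℝ} {a b : ℤ} {R : ℕ} {m₁ m₂ : ℂ[X]}

lemma proj_eq (hM : IsSpectralMatrix τ α β m₁ m₂) {r : ℝ} {V : ℂ → ℂ}
    (hV : IsFirstSheet τ a b R r V) {w : ℂ} (hw : w ∈ ball (zStar τ a b R) r) (i j : Fin 2) :
    proj τ α β V w i j = 1 / 2 * ((1 : Matrix (Fin 2) (Fin 2) ℂ) i j +
      (dwp τ (V w))⁻¹ * (specMat (wp τ (charPoint τ α β)) m₁ m₂ i j).eval w) := by
  have h1 := hV.notMem hw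
  have h2 := (dwp_eq_zero_iff h1).not.1 (hV.dwp_ne_zero hw)
  rw [proj, hM.conj_eq _ h1 h2, hV.wp_eq w hw]
  fin_cases i <;> fin_cases j <;> simp [specMat] <;> ring

/-- The projector equals `T` plus `(w - z⋆)^(2R)` times a holomorphic matrix, which contributes
nothing because `z` is outside the circle. The value `hσc` selects the square root belonging to the
sheet through `q`. -/
lemma contour_eq (hM : IsSpectralMatrix τ α β m₁ m₂) {σ : ℂ[X]}
    (hσc : σ.eval (zStar τ a b R) = (dwp τ (torsionPt τ a b R))⁻¹)
    (hσ : (X - C (zStar τ a b R)) ^ (2 * R) ∣ σ ^ 2 * cubic τ - 1) {r ε : ℝ} {V : ℂ → ℂ}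
    (hV : IsFirstSheet τ a b R r V) (hε : 0 < ε) (hr : ε < r) {z : ℂ}
    (hz : ε < ‖z - zStar τ a b R‖) (i j : Fin 2) :
    contour τ α β a b R V ε z i j =
      -((truncMat (zStar τ a b R) (2 * R) σ (specMat (wp τ (charPoint τ α β)) m₁ m₂) i j).eval z /
        (z - zStar τ a b R) ^ (2 * R)) := by
  set c := zStar τ a b R with hc
  set M := specMat (wp τ (charPoint τ α β)) m₁ m₂ with hMdef
  obtain ⟨h, hh, hhe⟩ := exists_remainder (p := cubic τ) (hε.trans hr)
    hV.differentiableOn_inv_dwp (fun w hw => by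
      have h1 := eval_cubic (hV.notMem hw)
      rw [hV.wp_eq w hw] at h1
      have h2 := hV.dwp_ne_zero hw
      rw [h1]
      field_simp) (by rw [hV.base, hσc]) hσ
  refine integral_div_of_eq_add (h := fun w => (halfMat σ M i j /ₘ (X - C c) ^ (2 * R)).eval w +
    1 / 2 * (h w * (M i j).eval w)) (degree_truncMat i j) ?_ hε hr hz fun w hw => ?_
  · exact (Polynomial.differentiable _).differentiableOn.add
      ((hh.mul (Polynomial.differentiable _).differentiableOn).const_mul _)
  · rw [proj_eq hM hV hw, hhe w hw]
    have h1 := congrArg (eval w) (halfMat_eq (c := c) (N := 2 * R) (σ := σ) (M := M) i j)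
    rw [eval_halfMat, eval_add, eval_mul, eval_pow, eval_sub, eval_X, eval_C] at h1
    linear_combination h1

lemma smul_sqrtW_inv (hX : theta1 τ (charPoint τ α β) ≠ 0) (hM : IsSpectralMatrix τ α β m₁ m₂)
    {e o : ℂ[X]} (hP : IsPellPair τ a b R e o) (hq : torsionPt τ a b R ∉ (periods τ).lattice)
    {v : ℂ} (hv : v ∉ (periods τ).lattice) (hv2 : 2 * v ∉ (periods τ).lattice)
    (h1 : v - torsionPt τ a b R ∉ (periods τ).lattice)
    (h2 : v + torsionPt τ a b R ∉ (periods τ).lattice) :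
    (wp τ v - zStar τ a b R) ^ R • (sqrtW τ α β a b R v)⁻¹ =
      (e • 1 + o • specMat (wp τ (charPoint τ α β)) m₁ m₂).map (eval (wp τ v)) := by
  have hd : dwp τ v ≠ 0 := (dwp_eq_zero_iff hv).not.2 hv2
  have hy := Y_ne_zero h1 h2
  have hu : IsUnit (Psi0 τ α β v).det := by
    rw [det_Psi0 hX hv]
    exact (neg_ne_zero.2 hd).isUnit
  have hinv : (sqrtW τ α β a b R v)⁻¹ =
      Psi0 τ α β v * !![(Y τ a b R v)⁻¹, 0; 0, Y τ a b R v] * (Psi0 τ α β v)⁻¹ := by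
    refine Matrix.inv_eq_right_inv ?_
    rw [sqrtW, Y_neg]
    have hD : !![Y τ a b R v, 0; 0, (Y τ a b R v)⁻¹] * !![(Y τ a b R v)⁻¹, 0; 0, Y τ a b R v] =
        (1 : Matrix (Fin 2) (Fin 2) ℂ) := by
      ext i j
      fin_cases i <;> fin_cases j <;> simp [Matrix.mul_apply, Fin.sum_univ_two, hy]
    calc _ = Psi0 τ α β v * !![Y τ a b R v, 0; 0, (Y τ a b R v)⁻¹] *
          ((Psi0 τ α β v)⁻¹ * Psi0 τ α β v) * !![(Y τ a b R v)⁻¹, 0; 0, Y τ a b R v] *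
            (Psi0 τ α β v)⁻¹ := by simp only [Matrix.mul_assoc]
      _ = Psi0 τ α β v * (!![Y τ a b R v, 0; 0, (Y τ a b R v)⁻¹] *
          !![(Y τ a b R v)⁻¹, 0; 0, Y τ a b R v]) * (Psi0 τ α β v)⁻¹ := by
          rw [Matrix.nonsing_inv_mul _ hu, Matrix.mul_one]; simp only [Matrix.mul_assoc]
      _ = 1 := by rw [hD, Matrix.mul_one, Matrix.mul_nonsing_inv _ hu]
  have e1 := regY_eq hq hv h1
  have e2 := regY_eq (a := a) (b := b) hq (v := -v) (by simpa using hv) (fun h => h2 (by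
    have := neg_mem h
    rwa [show -(-v - torsionPt τ a b R) = v + torsionPt τ a b R by ring] at this))
  rw [hP.regY_eq _ hv] at e1
  rw [hP.regY_eq _ (by simpa using hv), wp_neg, dwp_neg, Y_neg] at e2
  have f1 : (wp τ v - zStar τ a b R) ^ R * (((Y τ a b R v)⁻¹ + Y τ a b R v) / 2) =
      e.eval (wp τ v) := by linear_combination -(e1 + e2) / 2
  have f2 : (wp τ v - zStar τ a b R) ^ R * (((Y τ a b R v)⁻¹ - Y τ a b R v) / (2 * dwp τ v)) =
      o.eval (wp τ v) := by
    field_simp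
    field_simp at e1 e2 f1
    linear_combination Y τ a b R v * e1 - e2
  rw [hinv, hM.conj_eq v hv hv2, smul_add, smul_smul, smul_smul, f1, f2]
  ext i j
  fin_cases i <;> fin_cases j <;> simp [specMat]

end formula

end GenusOneTorsion

theorem mainTheorem11 (τ : UpperHalfPlane) (α β : ℝ) (a b : ℤ) (R : ℕ) (hR : 0 < R)
    -- the character does not lie on the theta divisor
    (hX : GenusOneTorsion.theta1 τ (GenusOneTorsion.charPoint τ α β) ≠ 0)
    -- the torsion point is not a half-period
    (hq : ¬ ((R : ℤ) ∣ a ∧ (R : ℤ) ∣ b)) :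
    -- the first sheet exists over a small disc around `z_⋆`
    (∃ r > 0, ∃ V : ℂ → ℂ, GenusOneTorsion.IsFirstSheet τ a b R r V) ∧
    -- the contour integral formula is given by one matrix polynomial
    ∃ P : Polynomial (Matrix (Fin 2) (Fin 2) ℂ),
      (∀ (r : ℝ) (V : ℂ → ℂ), GenusOneTorsion.IsFirstSheet τ a b R r V →
        ∀ ε : ℝ, 0 < ε → ε < r →
        ∀ v : ℂ, v ∉ (GenusOneTorsion.periods τ).lattice →
          2 * v ∉ (GenusOneTorsion.periods τ).lattice →
          ε < ‖GenusOneTorsion.wp τ v - GenusOneTorsion.zStar τ a b R‖ →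
          GenusOneTorsion.PR1 τ α β a b R V ε v =
            P.eval (Matrix.scalar (Fin 2) (GenusOneTorsion.wp τ v))) ∧
      P.natDegree ≤ R - 1 ∧
      -- the degree is exactly `R - 1` unless the square of the character is trivial
      (¬ (∃ m n : ℤ, 2 * α = m ∧ 2 * β = n) → P.natDegree = R - 1) := by
  open GenusOneTorsion Polynomial in
  have hq2 := two_mul_torsionPt_notMem (τ := τ) hR hq
  have hq1 := torsionPt_notMem (τ := τ) hR hq
  have hd : dwp τ (torsionPt τ a b R) ≠ 0 := (dwp_eq_zero_iff hq1).not.2 hq2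
  refine ⟨exists_isFirstSheet hq2, ?_⟩
  obtain ⟨m₁, m₂, hM⟩ := exists_isSpectralMatrix hX
  obtain ⟨e, o, hP⟩ := exists_isPellPair (R := R) (a := a) (b := b) hR hq2
  have hpc : (cubic τ).eval (zStar τ a b R) = dwp τ (torsionPt τ a b R) ^ 2 := eval_cubic hq1
  obtain ⟨σ, hσc, hσ⟩ := exists_inv_sqrt hd hpc (2 * R - 1)
  rw [Nat.sub_add_cancel (by omega)] at hσ
  -- At `z⋆` one has `σp = ℘'(q)`, so the nonvanishing condition required is `eval_ne`.
  have hmul := truncMat_mul_eq (specMat_mul_self hM.sq_eq) hσ (Dvd.intro_left 1 (by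
    rw [one_mul, hP.pell])) (by
      rw [hσc, hpc]
      intro h0
      apply hP.eval_ne
      rw [h0]
      field_simp
      ring)
  set Q := quotMat (zStar τ a b R) (2 * R) σ e o (specMat (wp τ (charPoint τ α β)) m₁ m₂) with hQ
  have hdeg : ∀ i j, (Q i j).natDegree ≤ R - 1 := natDegree_quotMat hR hP.natDegree_fst
    hP.natDegree_snd hM.natDegree_fst hM.natDegree_snd
  have hnat : (matPolyEquiv Q).natDegree ≤ R - 1 := by
    rw [natDegree_le_iff_coeff_eq_zero]
    intro n hn
    ext i j
    rw [matPolyEquiv_coeff_apply, coeff_eq_zero_of_natDegree_lt ((hdeg i j).trans_lt hn)]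
    rfl
  refine ⟨matPolyEquiv Q, fun r V hV ε hε hr v hv hv2 hz => ?_, hnat, fun hχ => ?_⟩
  · have hne : wp τ v ≠ wp τ (torsionPt τ a b R) := by
      intro h0
      rw [h0, zStar, sub_self, norm_zero] at hz
      exact hε.not_gt hz
    -- Hence `v` is not `±q` modulo the lattice, and `Y` is finite and nonzero at `v`.
    have h12 := (wp_eq_wp_iff hv hq1).not.1 hne
    rw [not_or] at h12
    have hs : wp τ v - zStar τ a b R ≠ 0 := sub_ne_zero.2 hne
    rw [PR1, ← Matrix.mul_smul, smul_sqrtW_inv hX hM hP hq1 hv hv2 h12.1 h12.2]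
    ext i j
    rw [matPolyEquiv_eval, Matrix.mul_apply]
    have h1 := congrArg (eval (wp τ v)) (hmul i j)
    rw [Matrix.mul_apply, eval_finsetSum] at h1
    simp only [eval_mul, eval_pow, eval_sub, eval_X, eval_C, eval_neg] at h1
    simp only [contour_eq hM hσc hσ hV hε hr hz, Matrix.map_apply, neg_mul, div_mul_eq_mul_div]
    rw [Finset.sum_neg_distrib, ← Finset.sum_div, h1]
    field_simp
  · by_contra hlt
    have hlt' : (matPolyEquiv Q).natDegree < R - 1 := lt_of_le_of_ne hnat hlt
    have hc0 : ∀ i j, (Q i j).coeff (R - 1) = 0 := fun i j => by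
      rw [← matPolyEquiv_coeff_apply, coeff_eq_zero_of_natDegree_lt hlt']
      rfl
    -- The upper right entry of `M` vanishes at `℘(𝒳)`, so there `m₁² = p`.
    have hy : m₁.eval (wp τ (charPoint τ α β)) ≠ 0 := by
      intro h0
      apply eval_cubic_charPoint_ne_zero hX hχ
      rw [← hM.sq_eq]
      simp [h0]
    obtain ⟨i, j, hij⟩ := exists_coeff_truncMat_ne_zero hR (natDegree_cubic τ).le
      (by rw [coeff_cubic_three]; norm_num) hσ hM.natDegree_fst hM.natDegree_snd
      (by rw [hM.coeff_snd]; norm_num) hy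
    exact hij (coeff_truncMat_eq_zero hR hP.natDegree_fst hP.coeff_fst hP.natDegree_snd
      hM.natDegree_fst hM.natDegree_snd hmul hc0 i j)
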